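/- Let $\omega:[0,1)\to(0,\infty)$ be non-decreasing, continuous, unbounded and doubling, i.e. there is a constant $B>1$ with $\omega(1-r/2)\le B\,\omega(1-r)$ for all $0<r\le 1$. Then there exist a strictly increasing sequence $(n_k)_{k\ge 0}$ of positive integers for which $a_k:=\omega(1-1/n_{k+2})/\omega(1-1/n_k)>1$ for every $k\ge 0$, and two functions $f_0,f_1$ analytic in the unit disc $\mathbb D$, given by the infinite products $$f_j(z)=\prod_{k=0}^\infty\frac{1+a_{2k+j}z^{n_{2k+j}}}{1+a_{2k+j}^{-1}z^{n_{2k+j}}},\qquad j=0,1,$$ which converge uniformly on compact subsets of $\mathbb D$, with the following properties. Here $u\asymp v$ means that $u\le Cv$ and $v\le Cu$ for some constant $C>0$. (1) $|f_0(z)|+|f_1(z)|\asymp\omega(|z|)$ for all $z\in\mathbb D$. (2) For $j=0,1$, the number $n(r,f_j,0)$ of zeros of $f_j$ in $\{|z|\le r\}$, counted with multiplicities, satisfies $n(r,f_j,0)=O\big((1-r)^{-1}\big)$ as $r\to1^-$. (3) For $j=0,1$ and every $0<p\le\infty$, $M_p(r,f_j)\asymp\omega(r)$ as $r\to1^-$,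 with a constant $C$ (and a range of $r$) that can be chosen independently of $p$. Here $M_\infty(r,f)=\max_{|z|=r}|f(z)|$ and $M_p(r,f)=\big(\frac1{2\pi}\int_0^{2\pi}|f(re^{i\theta})|^p\,d\theta\big)^{1/p}$ for $0<p<\infty$. (4) For $j=0,1$ and every $a\in\mathbb C$, $T(r,f_j)\asymp N(r,f_j,a)\asymp\log\omega(r)$ as $r\to1^-$ (with constants that may depend on $a$). Here $T(r,f)=\frac1{2\pi}\int_0^{2\pi}\log^+|f(re^{i\theta})|\,d\theta$ is the Nevanlinna characteristic and $N(r,f,a)=\int_0^r\frac{n(t,f,a)-n(0,f,a)}{t}\,dt+n(0,f,a)\log r$ is the integrated counting function, where $n(t,f,a)$ is the number of zeros of $f-a$ in $\{|z|\le t\}$, counted with multiplicities. -/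

import Mathlib

open Filter Topology

/-- A doubling function `ω : [0,1) → (0,∞)`: positive, non-decreasing, continuous and unbounded
on `[0,1)`, and such that `ω (1 - r/2) ≤ B * ω (1 - r)` for all `0 < r ≤ 1`, for some constant
`B > 1`. Only the values of `ω` on `[0,1)` matter. -/
structure IsDoublingFunction (ω : ℝ → ℝ) : Prop where
  pos : ∀ r ∈ Set.Ico (0 : ℝ) 1, 0 < ω r
  monotoneOn : MonotoneOn ω (Set.Ico 0 1)
  continuousOn : ContinuousOn ω (Set.Ico 0 1)
  unbounded : ¬ BddAbove (ω '' Set.Ico 0 1)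
  doubling : ∃ B : ℝ, 1 < B ∧ ∀ r ∈ Set.Ioc (0 : ℝ) 1, ω (1 - r / 2) ≤ B * ω (1 - r)

/-- `u x ≍ v x` along the filter `l`: eventually each is at most a constant times the other. -/
def ComparableAlong {α : Type*} (l : Filter α) (u v : α → ℝ) : Prop :=
  ∃ C : ℝ, 0 < C ∧ ∀ᶠ x in l, u x ≤ C * v x ∧ v x ≤ C * u x

/-- The non-integrated counting function `n(r, f, a)`: the number of zeros of `f - a` in the
closed disc `|z| ≤ r`, counted with multiplicities (for `f` analytic near the closed disc and not
identically equal to `a`). -/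
noncomputable def countingFunction (f : ℂ → ℂ) (a : ℂ) (r : ℝ) : ℕ :=
  ∑ᶠ z ∈ Metric.closedBall (0 : ℂ) r, analyticOrderNatAt (fun w => f w - a) z

/-- The integrated counting function of `a`-points
`N(r, f, a) = ∫₀^r (n(t, f, a) - n(0, f, a)) / t dt + n(0, f, a) log r`. -/
noncomputable def integratedCountingFunction (f : ℂ → ℂ) (a : ℂ) (r : ℝ) : ℝ :=
  (∫ t in (0 : ℝ)..r, ((countingFunction f a t : ℝ) - (countingFunction f a 0 : ℝ)) / t)
    + (countingFunction f a 0 : ℝ) * Real.log r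

/-- The Nevanlinna characteristic of an analytic function,
`T(r, f) = (1 / 2π) ∫₀^{2π} log⁺ |f(r e^{iθ})| dθ`. -/
noncomputable def nevanlinnaCharacteristic (f : ℂ → ℂ) (r : ℝ) : ℝ :=
  Real.circleAverage (fun z => Real.posLog ‖f z‖) 0 r

open scoped Classical in
/-- The means `M_p(r, f)`: for `p = ∞` the maximum modulus on the circle `|z| = r`, and for
`0 < p < ∞` the `L^p`-mean `((1 / 2π) ∫₀^{2π} |f(r e^{iθ})|^p dθ)^{1/p}`. -/
noncomputable def circleMean (p : ENNReal) (f : ℂ → ℂ) (r : ℝ) : ℝ :=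
  if p = ⊤ then sSup ((fun z => ‖f z‖) '' Metric.sphere (0 : ℂ) r)
  else (Real.circleAverage (fun z => ‖f z‖ ^ p.toReal) 0 r) ^ (1 / p.toReal)

/-- The ratios `a_k = ω(1 - 1/n_{k+2}) / ω(1 - 1/n_k)` attached to `ω` and a sequence `(n_k)`. -/
noncomputable def weightRatio (ω : ℝ → ℝ) (n : ℕ → ℕ) (k : ℕ) : ℝ :=
  ω (1 - 1 / (n (k + 2) : ℝ)) / ω (1 - 1 / (n k : ℝ))

/-- The function `z ↦ (1 + a_k z^{n_k}) / (1 + a_k⁻¹ z^{n_k})`. -/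
noncomputable def productFactor (ω : ℝ → ℝ) (n : ℕ → ℕ) (k : ℕ) (z : ℂ) : ℂ :=
  (1 + (weightRatio ω n k : ℂ) * z ^ n k) / (1 + (weightRatio ω n k : ℂ)⁻¹ * z ^ n k)

/-!
The factor `(1 + a w) / (1 + a⁻¹ w)` is `a` times a Blaschke factor in `w`: its modulus is close to
`a` when `|w|` is close to `1`, and it is close to `1` when `a |w|` is small. The exponents `n k` are
chosen so that `ω (1 - 1 / n k)` grows like a geometric sequence with a large ratio. By the doubling
condition they are then lacunary, and the ratios `a k` stay in a fixed interval
(`IsDoublingFunction.exists_isLacunary`). For `1 - 1 / n k ≤ |z| < 1 - 1 / n (k + 1)` the `i`-th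
factor of the product thus has modulus `a i` for `i < k` and `1` for `i > k + 1`, up to an error
decaying geometrically in `|i - k|` (`IsLacunary.norm_productFactor_bounds`). The product of the
`a i` with `i < k` of one parity telescopes to about `ω (1 - 1 / n k)`, so that each `|f_j|` is at
most a constant times `ω |z|`, and at least a constant times it unless `|z|` is close to the zeros of
the factor with index `k` or `k + 1` (`IsLacunary.norm_tprod_bounds`). By lacunarity at most one of
these two indices is critical at a given `|z|`, and they belong to different products, which gives
the joint growth. On the circles `|z| = 1 - 1 / n k` no index is critical, so there each `|f_j|` is
comparable to `ω`; these circles are dense enough for `ω` to vary by a bounded factor between them.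

The remaining properties only use these two facts about a single `f = f_j`, collected in `HasGrowth`.
By Jensen's formula `N(r, f, a)` is the circle average of `log |f - a|` up to a constant. It is at
most `log ω r + O(1)`, it is at least that on the good circles, and hence everywhere because it is
non-decreasing in `r`. The case `a = 0` bounds the geometric mean of `|f|` on every circle from below
by a constant times `ω`, hence all the means `M_p`, uniformly in `p`, and the characteristic.
Finally, doubling shows that `N(r, f, 0)` increases by a bounded amount when `1 - r` is halved. As
this increment is at least `n(r, f, 0) (1 - r) / 2`, the bound on the number of zeros follows without
locating the zeros.
-/

open Metric

/-! ### Counting functions and Jensen's formula -/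

/-- The zeros of `f - a` of positive finite order in a closed disc of radius less than one. -/
theorem finite_setOf_analyticOrderNatAt_ne_zero {f : ℂ → ℂ}
    (hf : AnalyticOnNhd ℂ f (ball 0 1)) (a : ℂ) {R : ℝ} (hR : R < 1) :
    {z ∈ closedBall (0 : ℂ) R | analyticOrderNatAt (fun w => f w - a) z ≠ 0}.Finite := by
  have hg : AnalyticOnNhd ℂ (fun w => f w - a) (closedBall 0 R) :=
    (hf.mono (closedBall_subset_ball hR)).sub analyticOnNhd_const
  refine ((MeromorphicOn.divisor (fun w => f w - a) (closedBall 0 R)).finiteSupport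
    (isCompact_closedBall 0 R)).subset ?_
  rintro z ⟨hz, h⟩
  rw [Function.mem_support, MeromorphicOn.AnalyticOnNhd.divisor_apply hg hz]
  have htop : analyticOrderAt (fun w => f w - a) z ≠ ⊤ := by
    intro h'; simp [analyticOrderNatAt, h'] at h
  rw [← Nat.cast_analyticOrderNatAt htop]
  simpa using h

/-- The positions of the zeros of `f - a` in the closed disc of radius `R`, as a finite set; it is
empty when `f` is identically equal to `a`. -/
noncomputable def zeroFinset {f : ℂ → ℂ} (hf : AnalyticOnNhd ℂ f (ball 0 1)) (a : ℂ) {R : ℝ}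
    (hR : R < 1) : Finset ℂ :=
  (finite_setOf_analyticOrderNatAt_ne_zero hf a hR).toFinset

section Counting

variable {f : ℂ → ℂ} (hf : AnalyticOnNhd ℂ f (ball 0 1)) (a : ℂ) {r R : ℝ} (hR : R < 1)

theorem mem_zeroFinset {z : ℂ} : z ∈ zeroFinset hf a hR ↔
    ‖z‖ ≤ R ∧ analyticOrderNatAt (fun w => f w - a) z ≠ 0 := by
  simp [zeroFinset]

theorem countingFunction_eq_sum (hrR : r ≤ R) :
    (countingFunction f a r : ℝ) = ∑ z ∈ zeroFinset hf a hR,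
      (analyticOrderNatAt (fun w => f w - a) z : ℝ) * (if ‖z‖ ≤ r then 1 else 0) := by
  unfold countingFunction
  have h : (∑ᶠ z ∈ closedBall (0 : ℂ) r, analyticOrderNatAt (fun w => f w - a) z) =
      ∑ z ∈ (zeroFinset hf a hR).filter (fun z => ‖z‖ ≤ r),
        analyticOrderNatAt (fun w => f w - a) z := by
    refine finsum_mem_eq_sum_of_inter_support_eq _ ?_
    ext z
    simp only [Set.mem_inter_iff, mem_closedBall_zero_iff, Function.mem_support,
      Finset.coe_filter, Set.mem_ofPred_eq, mem_zeroFinset]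
    constructor
    · rintro ⟨h1, h2⟩
      exact ⟨⟨⟨h1.trans hrR, h2⟩, h1⟩, h2⟩
    · rintro ⟨⟨⟨_, h2⟩, h1⟩, _⟩
      exact ⟨h1, h2⟩
  rw [h, Finset.sum_filter]
  push_cast
  exact Finset.sum_congr rfl fun z _ => by split_ifs <;> simp

theorem intervalIntegrable_and_integral_truncated_inv {s r : ℝ} (hs : 0 < s) (hr : 0 < r) :
    IntervalIntegrable (fun t : ℝ => (if s ≤ t then 1 else 0) / t) MeasureTheory.volume 0 r ∧
      ∫ t in (0 : ℝ)..r, (if s ≤ t then 1 else 0) / t = Real.posLog (r / s) := by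
  have hzero : ∀ b ≤ s, 0 ≤ b → Set.EqOn (fun _ : ℝ => (0 : ℝ))
      (fun t : ℝ => (if s ≤ t then 1 else 0) / t) (Set.uIoo 0 b) := by
    intro b hb hb0 t ht
    rw [Set.uIoo_of_le hb0] at ht
    simp [not_le.2 (ht.2.trans_le hb)]
  rcases le_total r s with hrs | hrs
  · constructor
    · exact (intervalIntegrable_const (c := (0 : ℝ))).congr_uIoo (hzero r hrs hr.le)
    · rw [← intervalIntegral.integral_congr_uIoo (hzero r hrs hr.le)]
      rw [intervalIntegral.integral_zero, eq_comm, Real.posLog_eq_zero_iff, abs_of_pos (by positivity)]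
      exact (div_le_one hs).2 hrs
  · have hinv : Set.EqOn (fun t : ℝ => t⁻¹)
        (fun t : ℝ => (if s ≤ t then 1 else 0) / t) (Set.uIoo s r) := by
      intro t ht
      rw [Set.uIoo_of_le hrs] at ht
      simp [ht.1.le]
    have h1 : IntervalIntegrable (fun t : ℝ => (if s ≤ t then 1 else 0) / t)
        MeasureTheory.volume 0 s :=
      (intervalIntegrable_const (c := (0 : ℝ))).congr_uIoo (hzero s le_rfl hs.le)
    have h2 : IntervalIntegrable (fun t : ℝ => (if s ≤ t then 1 else 0) / t)
        MeasureTheory.volume s r := by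
      refine IntervalIntegrable.congr_uIoo ?_ hinv
      exact intervalIntegral.intervalIntegrable_inv (fun t ht => by
        rw [Set.uIcc_of_le hrs] at ht; linarith [ht.1]) continuousOn_id
    refine ⟨h1.trans h2, ?_⟩
    rw [← intervalIntegral.integral_add_adjacent_intervals h1 h2,
      ← intervalIntegral.integral_congr_uIoo (hzero s le_rfl hs.le),
      ← intervalIntegral.integral_congr_uIoo hinv, integral_inv_of_pos hs hr,
      intervalIntegral.integral_zero, zero_add, Real.posLog_eq_log]
    rw [abs_of_pos (by positivity)]
    exact (one_le_div hs).2 hrs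

include hf hR in
theorem integratedCountingFunction_eq_sum (hr : 0 < r) (hrR : r ≤ R) :
    integratedCountingFunction f a r = ∑ z ∈ zeroFinset hf a hR,
      (analyticOrderNatAt (fun w => f w - a) z : ℝ) *
        (if z = 0 then Real.log r else Real.posLog (r / ‖z‖)) := by
  have hn0 := countingFunction_eq_sum hf a hR (hr.le.trans hrR)
  set Z := zeroFinset hf a hR
  set o : ℂ → ℝ := fun z => (analyticOrderNatAt (fun w => f w - a) z : ℝ)
  have hint : ∫ t in (0 : ℝ)..r, ((countingFunction f a t : ℝ) - (countingFunction f a 0 : ℝ)) / t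
      = ∑ z ∈ Z, o z * (if z = 0 then 0 else Real.posLog (r / ‖z‖)) := by
    have h1 : ∀ t ∈ Set.uIcc 0 r,
        ((countingFunction f a t : ℝ) - (countingFunction f a 0 : ℝ)) / t
          = ∑ z ∈ Z, o z * (if z = 0 then 0 else (if ‖z‖ ≤ t then 1 else 0) / t) := by
      intro t ht
      rw [Set.uIcc_of_le hr.le] at ht
      rw [countingFunction_eq_sum hf a hR (ht.2.trans hrR), hn0, ← Finset.sum_sub_distrib,
        Finset.sum_div]
      refine Finset.sum_congr rfl fun z _ => ?_
      by_cases hz : z = 0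
      · simp [hz, ht.1]
      · simp only [hz, if_false, ← mul_sub, o, mul_div_assoc]
        simp [hz]
    rw [intervalIntegral.integral_congr h1, intervalIntegral.integral_finsetSum]
    · refine Finset.sum_congr rfl fun z _ => ?_
      rw [intervalIntegral.integral_const_mul]
      congr 1
      by_cases hz : z = 0
      · simp [hz]
      · simp only [hz, if_false]
        exact (intervalIntegrable_and_integral_truncated_inv (norm_pos_iff.2 hz) hr).2
    · intro z _
      refine IntervalIntegrable.const_mul ?_ _
      by_cases hz : z = 0
      · simp [hz]
      · simp only [hz, if_false]
        exact (intervalIntegrable_and_integral_truncated_inv (norm_pos_iff.2 hz) hr).1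
  rw [integratedCountingFunction, hint, hn0, Finset.sum_mul, ← Finset.sum_add_distrib]
  refine Finset.sum_congr rfl fun z _ => ?_
  by_cases hz : z = 0 <;> simp [hz, o]

include hf in
/-- **Jensen's formula**, in terms of the integrated counting function. The constant is the
logarithm of the modulus of the first nonzero Taylor coefficient of `f - a` at the origin. -/
theorem integratedCountingFunction_eq_circleAverage (hr : 0 < r) (hr1 : r < 1) :
    integratedCountingFunction f a r = Real.circleAverage (fun z => Real.log ‖f z - a‖) 0 r
      - Real.log ‖meromorphicTrailingCoeffAt (fun w => f w - a) 0‖ := by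
  have hg : AnalyticOnNhd ℂ (fun w => f w - a) (closedBall 0 r) :=
    (hf.mono (closedBall_subset_ball hr1)).sub analyticOnNhd_const
  have hJ := MeromorphicOn.circleAverage_log_norm (c := 0) (R := r) hr.ne'
    (f := fun w => f w - a) (by rw [abs_of_pos hr]; exact hg.meromorphicOn)
  rw [abs_of_pos hr] at hJ
  rw [hJ, add_sub_cancel_right, integratedCountingFunction_eq_sum hf a hr1 hr le_rfl]
  have hdiv : ∀ z ∈ closedBall (0 : ℂ) r,
      ((MeromorphicOn.divisor (fun w => f w - a) (closedBall 0 r) z : ℤ) : ℝ)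
        = (analyticOrderNatAt (fun w => f w - a) z : ℝ) := by
    intro z hz
    rw [MeromorphicOn.AnalyticOnNhd.divisor_apply hg hz, analyticOrderNatAt]
    cases h : analyticOrderAt (fun w => f w - a) z <;> simp
  have h0 : (0 : ℂ) ∈ closedBall (0 : ℂ) r := by simp [hr.le]
  rw [finsum_eq_sum_of_support_subset (s := zeroFinset hf a hr1)]
  · have : ((MeromorphicOn.divisor (fun w => f w - a) (closedBall 0 r) 0 : ℤ) : ℝ) * Real.log r
        = ∑ z ∈ zeroFinset hf a hr1, (analyticOrderNatAt (fun w => f w - a) z : ℝ) *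
          (if z = 0 then Real.log r else 0) := by
      simp only [mul_ite, mul_zero]
      rw [Finset.sum_ite_eq', hdiv 0 h0]
      split_ifs with h
      · rfl
      · have : analyticOrderNatAt (fun w => f w - a) 0 = 0 := by
          by_contra h'
          exact h ((mem_zeroFinset hf a hr1).2 ⟨by simpa using hr.le, h'⟩)
        simp [this]
    rw [this, ← Finset.sum_add_distrib]
    refine Finset.sum_congr rfl fun z hz => ?_
    have hz' := ((mem_zeroFinset hf a hr1).1 hz).1
    rw [hdiv z (by simpa using hz'), ← mul_add]
    congr 1
    by_cases hz0 : z = 0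
    · simp [hz0]
    · simp only [hz0, if_false, add_zero, zero_sub, norm_neg, div_eq_mul_inv]
      have hzp := norm_pos_iff.2 hz0
      rw [Real.posLog_eq_log]
      rw [abs_of_pos (by positivity), ← div_eq_mul_inv]
      exact (one_le_div hzp).2 hz'
  · intro z hz
    rw [Function.mem_support] at hz
    have hzb : z ∈ closedBall (0 : ℂ) r := by
      by_contra h
      simp [Function.locallyFinsuppWithin.apply_eq_zero_of_notMem _ h] at hz
    rw [hdiv z hzb] at hz
    rw [Finset.mem_coe, mem_zeroFinset]
    exact ⟨by simpa using hzb, fun h => hz (by simp [h])⟩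

include hf hR in
/-- The growth of the integrated counting function controls the number of zeros. Since the left
side is nonnegative, this also contains the monotonicity of the integrated counting function. -/
theorem countingFunction_mul_log_le (hr : 0 < r) (hrR : r ≤ R) :
    (countingFunction f a r : ℝ) * Real.log (R / r)
      ≤ integratedCountingFunction f a R - integratedCountingFunction f a r := by
  have hR0 := hr.trans_le hrR
  rw [integratedCountingFunction_eq_sum hf a hR hr hrR,
    integratedCountingFunction_eq_sum hf a hR hR0 le_rfl,
    countingFunction_eq_sum hf a hR hrR, Finset.sum_mul, ← Finset.sum_sub_distrib]
  refine Finset.sum_le_sum fun z hz => ?_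
  rw [mul_assoc, ← mul_sub]
  refine mul_le_mul_of_nonneg_left ?_ (Nat.cast_nonneg _)
  by_cases hz0 : z = 0
  · simp [hz0, hr.le, Real.log_div hR0.ne' hr.ne']
  · have hzp := norm_pos_iff.2 hz0
    simp only [hz0, if_false]
    by_cases hzr : ‖z‖ ≤ r
    · have h1 : 1 ≤ r / ‖z‖ := (one_le_div hzp).2 hzr
      have h2 : 1 ≤ R / ‖z‖ := (one_le_div hzp).2 (hzr.trans hrR)
      rw [Real.posLog_eq_log (by rwa [abs_of_pos (by positivity)]),
        Real.posLog_eq_log (by rwa [abs_of_pos (by positivity)]),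
        Real.log_div hR0.ne' hr.ne', Real.log_div hr.ne' hzp.ne', Real.log_div hR0.ne' hzp.ne']
      simp [hzr]
    · simp only [hzr, if_false, zero_mul, sub_nonneg]
      exact Real.posLog_le_posLog (by positivity) (by gcongr)

end Counting

/-! ### Means and value distribution of functions of controlled growth -/

theorem IsDoublingFunction.tendsto_atTop {ω : ℝ → ℝ} (hω : IsDoublingFunction ω) :
    Tendsto ω (𝓝[<] 1) atTop := by
  rw [Filter.tendsto_atTop]
  intro b
  obtain ⟨_, ⟨s, hs, rfl⟩, hb⟩ := not_bddAbove_iff.1 hω.unbounded b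
  filter_upwards [Ioo_mem_nhdsLT hs.2] with r hr
  exact hb.le.trans (hω.monotoneOn hs ⟨hs.1.trans hr.1.le, hr.2⟩ hr.1.le)

theorem comparableAlong_of_abs_sub_le {α : Type*} {l : Filter α} {u v w : α → ℝ} {K K' : ℝ}
    (hw : Tendsto w l atTop) (hu : ∀ᶠ x in l, |u x - w x| ≤ K) (hv : ∀ᶠ x in l, |v x - w x| ≤ K') :
    ComparableAlong l u v := by
  refine ⟨3, by norm_num, ?_⟩
  filter_upwards [hu, hv, hw.eventually_ge_atTop (2 * K), hw.eventually_ge_atTop (2 * K')]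
    with x hu hv h1 h2
  rw [abs_le] at hu hv
  constructor <;> linarith

/-- `f` is analytic in the unit disc and of maximal growth `ω` in two respects: `|f|` is at most
`C ω` everywhere, and below every radius `r` there is a circle on which `|f|` is uniformly at least
`C⁻¹ ω r`. All the asymptotic properties of means and of value distribution follow from these. -/
structure HasGrowth (ω : ℝ → ℝ) (f : ℂ → ℂ) (C : ℝ) : Prop where
  one_le : 1 ≤ C
  analytic : AnalyticOnNhd ℂ f (ball 0 1)
  upper : ∀ z ∈ ball (0 : ℂ) 1, ‖f z‖ ≤ C * ω ‖z‖
  lower : ∀ r ∈ Set.Ico (0 : ℝ) 1, ∃ s ∈ Set.Icc 0 r, ∀ z : ℂ, ‖z‖ = s → ω r ≤ C * ‖f z‖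

theorem AnalyticOnNhd.circleIntegrable_log_norm_sub {f : ℂ → ℂ}
    (hf : AnalyticOnNhd ℂ f (ball 0 1)) (a : ℂ) {r : ℝ} (hr : 0 < r) (hr1 : r < 1) :
    CircleIntegrable (fun z => Real.log ‖f z - a‖) 0 r :=
  (((hf.mono ((sphere_subset_closedBall).trans (closedBall_subset_ball hr1))).sub
    analyticOnNhd_const).meromorphicOn).circleIntegrable_log_norm_of_nonneg hr.le

theorem AnalyticOnNhd.continuousOn_sphere {f : ℂ → ℂ}
    (hf : AnalyticOnNhd ℂ f (ball 0 1)) {r : ℝ} (hr1 : r < 1) :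
    ContinuousOn f (sphere 0 r) :=
  hf.continuousOn.mono ((sphere_subset_closedBall).trans (closedBall_subset_ball hr1))

open MeasureTheory in
theorem exp_circleAverage_le_circleAverage_exp {g : ℂ → ℝ} {c : ℂ} {r : ℝ}
    (hg : CircleIntegrable g c r) (hge : CircleIntegrable (fun z => Real.exp (g z)) c r) :
    Real.exp (Real.circleAverage g c r) ≤ Real.circleAverage (fun z => Real.exp (g z)) c r := by
  have hpi : (0 : ℝ) < 2 * Real.pi := Real.two_pi_pos
  rw [Real.circleAverage_eq_intervalAverage, Real.circleAverage_eq_intervalAverage]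
  have : NeZero (volume.restrict (Set.uIoc 0 (2 * Real.pi))) := by
    refine ⟨fun h => ?_⟩
    rw [Measure.restrict_eq_zero, Set.uIoc_of_le hpi.le, Real.volume_Ioc] at h
    simp at h
    linarith
  have : IsFiniteMeasure (volume.restrict (Set.uIoc 0 (2 * Real.pi))) := by
    rw [Set.uIoc_of_le hpi.le]
    infer_instance
  exact convexOn_exp.map_average_le Real.continuous_exp.continuousOn isClosed_univ
    (ae_of_all _ fun _ => Set.mem_univ _) (intervalIntegrable_iff.1 hg)
    (intervalIntegrable_iff.1 hge)

/-- Jensen's inequality: the geometric mean of `|f|` over a circle is at most its `L^p`-mean for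
every `0 < p ≤ ∞`. -/
theorem exp_circleAverage_log_le_circleMean {f : ℂ → ℂ} (hf : AnalyticOnNhd ℂ f (ball 0 1))
    (hf0 : f 0 ≠ 0) {r : ℝ} (hr : 0 < r) (hr1 : r < 1) {p : ENNReal} (hp : 0 < p) :
    Real.exp (Real.circleAverage (fun z => Real.log ‖f z‖) 0 r) ≤ circleMean p f r := by
  have hcont := hf.continuousOn_sphere hr1
  have hlog : CircleIntegrable (fun z => Real.log ‖f z‖) 0 r := by
    simpa using hf.circleIntegrable_log_norm_sub 0 hr hr1
  have hne : ∀ᶠ z in codiscreteWithin (sphere (0 : ℂ) |r|), f z ≠ 0 := by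
    have := hf.preimage_zero_mem_codiscreteWithin hf0 (by simp)
      ⟨⟨0, by simp⟩, (convex_ball (0 : ℂ) 1).isPreconnected⟩
    refine codiscreteWithin_mono ?_ this
    rw [abs_of_pos hr]
    exact sphere_subset_closedBall.trans (closedBall_subset_ball hr1)
  have hpow : ∀ q : ℝ, 0 < q → CircleIntegrable (fun z => ‖f z‖ ^ q) 0 r := fun q hq =>
    ContinuousOn.circleIntegrable hr.le (hcont.norm.rpow_const fun _ _ => Or.inr hq.le)
  have hfin : ∀ q : ℝ, 0 < q → Real.exp (Real.circleAverage (fun z => Real.log ‖f z‖) 0 r) ≤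
      Real.circleAverage (fun z => ‖f z‖ ^ q) 0 r ^ (1 / q) := by
    intro q hq
    -- at the zeros of `f` the two sides differ, since `Real.log 0 = 0`
    have heq : (fun z => Real.exp (q * Real.log ‖f z‖)) =ᶠ[codiscreteWithin (sphere (0 : ℂ) |r|)]
        (fun z => ‖f z‖ ^ q) := by
      filter_upwards [hne] with z hz
      rw [Real.rpow_def_of_pos (norm_pos_iff.2 hz), mul_comm]
    have h1 := exp_circleAverage_le_circleAverage_exp (g := fun z => q * Real.log ‖f z‖)
      hlog.const_smul ((hpow q hq).congr_codiscreteWithin heq.symm)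
    have h2 : Real.circleAverage (fun z => q * Real.log ‖f z‖) 0 r
        = q * Real.circleAverage (fun z => Real.log ‖f z‖) 0 r :=
      Real.circleAverage_fun_smul (a := q) (f := fun z => Real.log ‖f z‖)
    rw [Real.circleAverage_congr_codiscreteWithin heq hr.ne', h2] at h1
    refine (Real.le_rpow_inv_iff_of_pos (Real.exp_nonneg _) ((Real.exp_nonneg _).trans h1) hq).2 ?_
      |>.trans_eq (by rw [one_div])
    rwa [← Real.exp_mul, mul_comm]
  unfold circleMean
  split_ifs with hpt
  · refine (hfin 1 one_pos).trans ?_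
    simp only [Real.rpow_one, div_one]
    refine Real.circleAverage_mono_on_of_le_circle (by simpa using hpow 1 one_pos) fun z hz => ?_
    rw [abs_of_pos hr] at hz
    exact le_csSup ((isCompact_sphere 0 r).bddAbove_image hcont.norm) ⟨z, hz, rfl⟩
  · exact hfin _ (ENNReal.toReal_pos hp.ne' hpt)

theorem circleMean_le {f : ℂ → ℂ} (hf : AnalyticOnNhd ℂ f (ball 0 1)) {r : ℝ} (hr : 0 < r)
    (hr1 : r < 1) {p : ENNReal} (hp : 0 < p) {M : ℝ} (hM : ∀ z : ℂ, ‖z‖ = r → ‖f z‖ ≤ M) :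
    circleMean p f r ≤ M := by
  have hcont := hf.continuousOn_sphere hr1
  have hr' : ‖(r : ℂ)‖ = r := by simp [hr.le]
  have hM0 : 0 ≤ M := (norm_nonneg _).trans (hM r hr')
  unfold circleMean
  split_ifs with hpt
  · refine csSup_le ⟨_, r, by simpa using hr.le, rfl⟩ ?_
    rintro _ ⟨z, hz, rfl⟩
    exact hM z (by simpa using hz)
  · have hp' : 0 < p.toReal := ENNReal.toReal_pos hp.ne' hpt
    have h1 : Real.circleAverage (fun z => ‖f z‖ ^ p.toReal) 0 r ≤ M ^ p.toReal := by
      refine Real.circleAverage_mono_on_of_le_circle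
        (ContinuousOn.circleIntegrable hr.le (hcont.norm.rpow_const fun _ _ => Or.inr hp'.le))
        fun z hz => ?_
      exact Real.rpow_le_rpow (norm_nonneg _) (hM z (by simpa [abs_of_pos hr] using hz)) hp'.le
    have h0 : 0 ≤ Real.circleAverage (fun z => ‖f z‖ ^ p.toReal) 0 r :=
      Real.circleAverage_nonneg_of_nonneg fun z _ => by positivity
    calc _ ≤ (M ^ p.toReal) ^ (1 / p.toReal) := by gcongr
      _ = M := by rw [one_div, Real.rpow_rpow_inv hM0 hp'.ne']

namespace HasGrowth

variable {ω : ℝ → ℝ} {f : ℂ → ℂ} {C : ℝ}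

theorem apply_zero_ne (hf : HasGrowth ω f C) (hω : IsDoublingFunction ω) : f 0 ≠ 0 := by
  obtain ⟨s, hs, h⟩ := hf.lower 0 (by simp)
  intro h0
  have := h 0 (by rw [norm_zero]; exact le_antisymm hs.1 hs.2)
  have := hω.pos 0 (by simp)
  simp_all
  linarith

/-- For every `a` the counting function `N(r, f, a)` is `log ω r` up to a bounded error. The lower
bound is proved at a smaller radius on which `|f - a|` is large everywhere, and carries over since
`N(·, f, a)` is non-decreasing. -/
theorem exists_abs_integratedCountingFunction_sub_log_le (hf : HasGrowth ω f C)
    (hω : IsDoublingFunction ω) (a : ℂ) : ∃ K : ℝ, ∀ᶠ r in 𝓝[<] (1 : ℝ),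
      |integratedCountingFunction f a r - Real.log (ω r)| ≤ K := by
  set c := Real.log ‖meromorphicTrailingCoeffAt (fun w => f w - a) 0‖
  have hC := hf.one_le
  have hC0 : 0 < C := by linarith
  refine ⟨Real.log (2 * C) + |c|, ?_⟩
  have hev1 := hω.tendsto_atTop.eventually_ge_atTop (1 + 2 * C * ‖a‖)
  have hev2 := hω.tendsto_atTop.eventually_gt_atTop (C * (C * ω 0))
  filter_upwards [hev1, hev2, Ioo_mem_nhdsLT one_pos] with r h1 h2 hr
  have hω0 : 0 < ω r := hω.pos r ⟨hr.1.le, hr.2⟩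
  have ha := norm_nonneg a
  have haω : 2 * C * ‖a‖ ≤ ω r := by linarith
  have hω1 : 1 ≤ ω r := by nlinarith
  rw [abs_le]
  constructor
  · obtain ⟨s, hs, hlow⟩ := hf.lower r ⟨hr.1.le, hr.2⟩
    have hs1 : s < 1 := hs.2.trans_lt hr.2
    -- `s = 0` is impossible, as `f 0` is too small
    have hs0 : 0 < s := by
      rcases hs.1.eq_or_lt with h | h
      · subst h
        have h3 := hlow 0 norm_zero
        have h4 := hf.upper 0 (by simp)
        rw [norm_zero] at h4
        nlinarith
      · exact h
    have hmono := (mul_nonneg (Nat.cast_nonneg (countingFunction f a s))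
      (Real.log_nonneg ((one_le_div hs0).2 hs.2))).trans
      (countingFunction_mul_log_le hf.analytic a hr.2 hs0 hs.2)
    have hJ := integratedCountingFunction_eq_circleAverage hf.analytic a hs0 hs1
    have havg : Real.log (ω r / (2 * C)) ≤
        Real.circleAverage (fun z => Real.log ‖f z - a‖) 0 s := by
      rw [← Real.circleAverage_const (Real.log (ω r / (2 * C))) 0 s]
      refine Real.circleAverage_mono (circleIntegrable_const _ _ _)
        (hf.analytic.circleIntegrable_log_norm_sub a hs0 hs1) fun z hz => ?_
      have h3 := hlow z (by simpa [abs_of_pos hs0] using hz)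
      refine Real.log_le_log (by positivity) ?_
      have h4 := norm_sub_norm_le (f z) a
      rw [div_le_iff₀ (by positivity)]
      nlinarith
    rw [Real.log_div hω0.ne' (by positivity)] at havg
    linarith [le_abs_self c]
  · have hJ := integratedCountingFunction_eq_circleAverage hf.analytic a hr.1 hr.2
    have havg : Real.circleAverage (fun z => Real.log ‖f z - a‖) 0 r ≤
        Real.log (2 * C * ω r) := by
      refine Real.circleAverage_mono_on_of_le_circle
        (hf.analytic.circleIntegrable_log_norm_sub a hr.1 hr.2) fun z hz => ?_
      have hz' : ‖z‖ = r := by simpa [abs_of_pos hr.1] using hz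
      rcases (norm_nonneg (f z - a)).eq_or_lt with h0 | h0
      · rw [← h0, Real.log_zero]
        exact Real.log_nonneg (by nlinarith)
      · refine Real.log_le_log h0 ?_
        have h3 := hf.upper z (by simpa [hz'] using hr.2)
        rw [hz'] at h3
        have h4 := norm_sub_le (f z) a
        nlinarith
    rw [Real.log_mul (by positivity) hω0.ne'] at havg
    linarith [neg_abs_le c]

theorem exists_log_sub_le_circleAverage (hf : HasGrowth ω f C) (hω : IsDoublingFunction ω) :
    ∃ K : ℝ, ∀ᶠ r in 𝓝[<] (1 : ℝ),
      Real.log (ω r) - K ≤ Real.circleAverage (fun z => Real.log ‖f z‖) 0 r := by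
  obtain ⟨K, hK⟩ := hf.exists_abs_integratedCountingFunction_sub_log_le hω 0
  refine ⟨K - Real.log ‖meromorphicTrailingCoeffAt (fun w => f w - 0) 0‖, ?_⟩
  filter_upwards [hK, Ioo_mem_nhdsLT one_pos] with r h hr
  rw [integratedCountingFunction_eq_circleAverage hf.analytic 0 hr.1 hr.2, abs_le] at h
  simp only [sub_zero] at h ⊢
  linarith

theorem exists_abs_nevanlinnaCharacteristic_sub_log_le (hf : HasGrowth ω f C)
    (hω : IsDoublingFunction ω) : ∃ K : ℝ, ∀ᶠ r in 𝓝[<] (1 : ℝ),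
      |nevanlinnaCharacteristic f r - Real.log (ω r)| ≤ K := by
  obtain ⟨K, hK⟩ := hf.exists_log_sub_le_circleAverage hω
  have hC := hf.one_le
  refine ⟨max K (Real.log C), ?_⟩
  filter_upwards [hK, hω.tendsto_atTop.eventually_ge_atTop 1, Ioo_mem_nhdsLT one_pos]
    with r h hω1 hr
  have hmero : MeromorphicOn f (sphere 0 r) := (hf.analytic.mono
    (sphere_subset_closedBall.trans (closedBall_subset_ball hr.2))).meromorphicOn
  have hint : CircleIntegrable (fun z => Real.posLog ‖f z‖) 0 r :=
    hmero.circleIntegrable_posLog_norm_of_nonneg hr.1.le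
  rw [abs_le]
  constructor
  · have : Real.circleAverage (fun z => Real.log ‖f z‖) 0 r ≤ nevanlinnaCharacteristic f r :=
      Real.circleAverage_mono (hmero.circleIntegrable_log_norm_of_nonneg hr.1.le) hint
        fun z _ => le_max_right _ _
    linarith [le_max_left K (Real.log C)]
  · have : nevanlinnaCharacteristic f r ≤ Real.log (C * ω r) := by
      refine Real.circleAverage_mono_on_of_le_circle hint fun z hz => ?_
      have hz' : ‖z‖ = r := by simpa [abs_of_pos hr.1] using hz
      have h3 := hf.upper z (by simpa [hz'] using hr.2)
      rw [hz'] at h3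
      refine (Real.posLog_le_posLog (norm_nonneg _) h3).trans_eq (Real.posLog_eq_log ?_)
      rw [abs_of_nonneg (by nlinarith)]
      nlinarith
    rw [Real.log_mul (by linarith) (by linarith)] at this
    linarith [le_max_right K (Real.log C)]

theorem comparableAlong (hf : HasGrowth ω f C) (hω : IsDoublingFunction ω) (a : ℂ) :
    ComparableAlong (𝓝[<] 1) (nevanlinnaCharacteristic f) (integratedCountingFunction f a) ∧
      ComparableAlong (𝓝[<] 1) (integratedCountingFunction f a) (fun r => Real.log (ω r)) := by
  obtain ⟨K, hK⟩ := hf.exists_abs_integratedCountingFunction_sub_log_le hω a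
  obtain ⟨K', hK'⟩ := hf.exists_abs_nevanlinnaCharacteristic_sub_log_le hω
  have hlog : Tendsto (fun r => Real.log (ω r)) (𝓝[<] 1) atTop :=
    Real.tendsto_log_atTop.comp hω.tendsto_atTop
  exact ⟨comparableAlong_of_abs_sub_le hlog hK' hK, comparableAlong_of_abs_sub_le hlog hK
    (K' := 0) (by simp)⟩

theorem exists_circleMean_bounds (hf : HasGrowth ω f C) (hω : IsDoublingFunction ω) :
    ∃ C : ℝ, 0 < C ∧ ∀ᶠ r in 𝓝[<] (1 : ℝ), ∀ p : ENNReal, 0 < p →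
      circleMean p f r ≤ C * ω r ∧ ω r ≤ C * circleMean p f r := by
  obtain ⟨K, hK⟩ := hf.exists_log_sub_le_circleAverage hω
  have hC := hf.one_le
  refine ⟨max C (Real.exp K), by positivity, ?_⟩
  filter_upwards [hK, Ioo_mem_nhdsLT one_pos] with r h hr p hp
  have hω0 : 0 < ω r := hω.pos r ⟨hr.1.le, hr.2⟩
  have hup : circleMean p f r ≤ C * ω r := circleMean_le hf.analytic hr.1 hr.2 hp fun z hz => by
    have := hf.upper z (by simpa [hz] using hr.2)
    rwa [hz] at this
  have hlow := exp_circleAverage_log_le_circleMean hf.analytic (hf.apply_zero_ne hω) hr.1 hr.2 hp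
  constructor
  · exact hup.trans (mul_le_mul_of_nonneg_right (le_max_left _ _) hω0.le)
  · have h1 : ω r ≤ Real.exp K * circleMean p f r := by
      calc ω r = Real.exp K * Real.exp (Real.log (ω r) - K) := by
            rw [← Real.exp_add, add_sub_cancel, Real.exp_log hω0]
        _ ≤ _ := by gcongr; exact (Real.exp_le_exp.2 h).trans hlow
    exact h1.trans (mul_le_mul_of_nonneg_right (le_max_right _ _)
      ((Real.exp_nonneg _).trans hlow))

/-- The number of zeros is `O(1 / (1 - r))`: halving the distance to the unit circle increases
`log ω`, hence `N(·, f, 0)`, by a bounded amount only. -/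
theorem countingFunction_isBigO (hf : HasGrowth ω f C) (hω : IsDoublingFunction ω) (a : ℂ) :
    (fun r : ℝ => (countingFunction f a r : ℝ)) =O[𝓝[<] 1] (fun r : ℝ => (1 - r)⁻¹) := by
  obtain ⟨K, hK⟩ := hf.exists_abs_integratedCountingFunction_sub_log_le hω a
  obtain ⟨B, hB1, hB⟩ := hω.doubling
  have hhalf : Tendsto (fun r : ℝ => (1 + r) / 2) (𝓝[<] 1) (𝓝[<] 1) := by
    refine tendsto_nhdsWithin_iff.2 ⟨?_, ?_⟩
    · refine Tendsto.mono_left ?_ nhdsWithin_le_nhds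
      have : Continuous fun r : ℝ => (1 + r) / 2 := by fun_prop
      simpa using this.tendsto 1
    · filter_upwards [self_mem_nhdsWithin] with r hr
      rw [Set.mem_Iio] at hr ⊢
      linarith
  refine Asymptotics.IsBigO.of_bound (2 * (2 * K + Real.log B)) ?_
  filter_upwards [hK, hhalf.eventually hK, Ioo_mem_nhdsLT one_pos] with r h1 h2 hr
  have hr0 : 0 < 1 - r := by linarith [hr.2]
  have hn := countingFunction_mul_log_le hf.analytic a (R := (1 + r) / 2) (by linarith) hr.1
    (by linarith)
  have hωr : 0 < ω r := hω.pos r ⟨hr.1.le, hr.2⟩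
  have hωR : 0 < ω ((1 + r) / 2) := hω.pos _ ⟨by linarith [hr.1], by linarith⟩
  have hdoub := hB (1 - r) ⟨hr0, by linarith [hr.1]⟩
  rw [show 1 - (1 - r) / 2 = (1 + r) / 2 by ring, sub_sub_cancel] at hdoub
  have hlog := Real.log_le_log hωR hdoub
  rw [Real.log_mul (by linarith) hωr.ne'] at hlog
  rw [abs_le] at h1 h2
  have hlow : (1 - r) / 2 ≤ Real.log ((1 + r) / 2 / r) := by
    have h3 := Real.one_sub_inv_le_log_of_pos (x := (1 + r) / 2 / r)
      (by have := hr.1; positivity)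
    refine le_trans ?_ h3
    have := hr.1
    rw [inv_div, le_sub_iff_add_le, ← le_sub_iff_add_le', div_le_iff₀ (by linarith)]
    nlinarith [hr.2]
  have hmain := (mul_le_mul_of_nonneg_left hlow
    (Nat.cast_nonneg (α := ℝ) (countingFunction f a r))).trans hn
  rw [Real.norm_of_nonneg (Nat.cast_nonneg _), Real.norm_of_nonneg (by positivity),
    ← div_eq_mul_inv, le_div_iff₀ hr0]
  linarith

end HasGrowth

/-! ### Estimates for a single factor -/

theorem exp_neg_two_mul_le_one_sub {y : ℝ} (hy0 : 0 ≤ y) (hy : y ≤ 1 / 2) :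
    Real.exp (-(2 * y)) ≤ 1 - y := by
  rw [Real.exp_neg, inv_le_comm₀ (Real.exp_pos _) (by linarith)]
  refine le_trans ?_ (Real.add_one_le_exp (2 * y))
  rw [inv_le_iff_one_le_mul₀ (by linarith)]
  nlinarith

section Factor

variable {a : ℝ} {w : ℂ}

theorem norm_sq_add_sub_norm_sq_one_add (a : ℝ) (w : ℂ) :
    ‖(a : ℂ) + w‖ ^ 2 - ‖1 + a * w‖ ^ 2 = (a ^ 2 - 1) * (1 - ‖w‖ ^ 2) := by
  simp only [← Complex.normSq_eq_norm_sq, Complex.normSq_apply, Complex.add_re, Complex.add_im,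
    Complex.mul_re, Complex.mul_im, Complex.ofReal_re, Complex.ofReal_im, Complex.one_re,
    Complex.one_im]
  ring

theorem norm_factor (ha : 0 < a) :
    ‖(1 + (a : ℂ) * w) / (1 + (a : ℂ)⁻¹ * w)‖ = a * (‖1 + a * w‖ / ‖(a : ℂ) + w‖) := by
  have ha' : (a : ℂ) ≠ 0 := by exact_mod_cast ha.ne'
  rw [show (1 + (a : ℂ)⁻¹ * w) = (a : ℂ)⁻¹ * (a + w) by field_simp, norm_div, norm_mul, norm_inv,
    Complex.norm_real, Real.norm_of_nonneg ha.le]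
  simp only [div_eq_mul_inv, mul_inv, inv_inv]
  ring

theorem sub_one_le_norm_add (ha : 1 < a) (hw : ‖w‖ ≤ 1) : a - 1 ≤ ‖(a : ℂ) + w‖ := by
  have h := norm_sub_le ((a : ℂ) + w) w
  rw [add_sub_cancel_right, Complex.norm_real, Real.norm_of_nonneg (by linarith)] at h
  linarith

/-- `a⁻¹` times the factor is a Blaschke factor in `w`. -/
theorem norm_one_add_mul_le (ha : 1 < a) (hw : ‖w‖ ≤ 1) :
    ‖1 + a * w‖ ≤ ‖(a : ℂ) + w‖ := by
  have h := norm_sq_add_sub_norm_sq_one_add a w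
  have h1 : 0 ≤ (a ^ 2 - 1) * (1 - ‖w‖ ^ 2) :=
    mul_nonneg (by nlinarith) (by nlinarith [norm_nonneg w])
  exact (pow_le_pow_iff_left₀ (norm_nonneg _) (norm_nonneg _) two_ne_zero).1 (by linarith)

theorem norm_factor_le (ha : 1 < a) (hw : ‖w‖ ≤ 1) :
    ‖(1 + (a : ℂ) * w) / (1 + (a : ℂ)⁻¹ * w)‖ ≤ a := by
  rw [norm_factor (by linarith)]
  have h1 := sub_one_le_norm_add ha hw
  exact mul_le_of_le_one_right (by linarith)
    (div_le_one_of_le₀ (norm_one_add_mul_le ha hw) (norm_nonneg _))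

/-- Close to the unit circle the modulus of the factor is close to its boundary value `a`. -/
theorem le_norm_factor_of_near_one (ha : 3 ≤ a) (hw : ‖w‖ ≤ 1) :
    a * (1 - 4 * (1 - ‖w‖)) ≤ ‖(1 + (a : ℂ) * w) / (1 + (a : ℂ)⁻¹ * w)‖ := by
  rw [norm_factor (by linarith)]
  have ha1 : 1 < a := by linarith
  have hQ := sub_one_le_norm_add ha1 hw
  have hPQ := norm_one_add_mul_le ha1 hw
  have h := norm_sq_add_sub_norm_sq_one_add a w
  have hw0 := norm_nonneg w
  set P := ‖1 + a * w‖
  set Q := ‖(a : ℂ) + w‖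
  have hQ0 : 0 < Q := by linarith
  refine mul_le_mul_of_nonneg_left ?_ (by linarith)
  rw [le_div_iff₀ hQ0]
  have h1 : (a ^ 2 - 1) * (1 - ‖w‖ ^ 2) ≤ 4 * (1 - ‖w‖) * Q ^ 2 := by
    have h2 : a ^ 2 - 1 ≤ 2 * Q ^ 2 := by nlinarith
    have h3 : 1 - ‖w‖ ^ 2 ≤ 2 * (1 - ‖w‖) := by nlinarith
    calc (a ^ 2 - 1) * (1 - ‖w‖ ^ 2) ≤ (2 * Q ^ 2) * (2 * (1 - ‖w‖)) := by
          apply mul_le_mul h2 h3 (by nlinarith) (by positivity)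
      _ = _ := by ring
  have hP0 : 0 ≤ P := norm_nonneg _
  have h4 : (1 - 4 * (1 - ‖w‖)) * Q * Q ≤ P * Q := by nlinarith
  exact le_of_mul_le_mul_right h4 hQ0

/-- Where `a |w|` is small the factor is close to `1`. -/
theorem norm_factor_bounds_of_small (ha : 1 < a) (hw : a * ‖w‖ ≤ 1 / 2) :
    Real.exp (-(4 * (a * ‖w‖))) ≤ ‖(1 + (a : ℂ) * w) / (1 + (a : ℂ)⁻¹ * w)‖ ∧
      ‖(1 + (a : ℂ) * w) / (1 + (a : ℂ)⁻¹ * w)‖ ≤ Real.exp (4 * (a * ‖w‖)) := by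
  have ha0 : 0 < a := by linarith
  set y := a * ‖w‖ with hy
  have hy0 : 0 ≤ y := by positivity
  have h1 : ‖(a : ℂ) * w‖ = y := by simp [hy, abs_of_pos ha0]
  have h2 : ‖(a : ℂ)⁻¹ * w‖ ≤ y := by
    rw [norm_mul, norm_inv, Complex.norm_real, Real.norm_of_nonneg ha0.le]
    exact mul_le_mul_of_nonneg_right ((inv_le_one_of_one_le₀ ha.le).trans ha.le) (norm_nonneg _)
  have hbd : ∀ u : ℂ, ‖u‖ ≤ y → 1 - y ≤ ‖1 + u‖ ∧ ‖1 + u‖ ≤ 1 + y := by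
    intro u hu
    have h3 := norm_sub_le (1 + u) u
    have h4 := norm_add_le 1 u
    rw [add_sub_cancel_right] at h3
    rw [norm_one] at h3 h4
    constructor <;> linarith
  obtain ⟨n1, n2⟩ := hbd _ h1.le
  obtain ⟨d1, d2⟩ := hbd _ h2
  have he := exp_neg_two_mul_le_one_sub hy0 hw
  have he' := Real.add_one_le_exp y
  have hdpos : 0 < ‖1 + (a : ℂ)⁻¹ * w‖ := by linarith
  rw [norm_div]
  constructor
  · rw [le_div_iff₀ hdpos]
    calc Real.exp (-(4 * y)) * ‖1 + (a : ℂ)⁻¹ * w‖ ≤ Real.exp (-(4 * y)) * Real.exp (2 * y) := by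
          gcongr
          refine d2.trans (le_trans ?_ (Real.exp_le_exp.2 (by linarith : y ≤ 2 * y)))
          linarith
      _ = Real.exp (-(2 * y)) := by rw [← Real.exp_add]; ring_nf
      _ ≤ _ := he.trans n1
  · rw [div_le_iff₀ hdpos]
    calc ‖1 + (a : ℂ) * w‖ ≤ Real.exp (2 * y) :=
          (n2.trans (by linarith)).trans (Real.exp_le_exp.2 (by linarith : y ≤ 2 * y))
      _ = Real.exp (4 * y) * Real.exp (-(2 * y)) := by rw [← Real.exp_add]; ring_nf
      _ ≤ _ := by gcongr; exact he.trans d1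

theorem quarter_le_norm_factor (ha : 1 < a) (hw1 : ‖w‖ ≤ 1)
    (hw : a * ‖w‖ ≤ 1 / 2 ∨ 2 ≤ a * ‖w‖) :
    1 / 4 ≤ ‖(1 + (a : ℂ) * w) / (1 + (a : ℂ)⁻¹ * w)‖ := by
  have ha0 : 0 < a := by linarith
  have h1 : ‖(a : ℂ) * w‖ = a * ‖w‖ := by simp [abs_of_pos ha0]
  have h2 : ‖(a : ℂ)⁻¹ * w‖ ≤ 1 := by
    rw [norm_mul, norm_inv, Complex.norm_real, Real.norm_of_nonneg ha0.le]
    exact mul_le_one₀ (inv_le_one_of_one_le₀ ha.le) (norm_nonneg _) hw1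
  have hden : ‖1 + (a : ℂ)⁻¹ * w‖ ≤ 2 := by
    have := norm_add_le 1 ((a : ℂ)⁻¹ * w)
    rw [norm_one] at this
    linarith
  have hnum : 1 / 2 ≤ ‖1 + (a : ℂ) * w‖ := by
    rcases hw with hw | hw
    · have h3 := norm_sub_le (1 + (a : ℂ) * w) (a * w)
      rw [add_sub_cancel_right, norm_one] at h3
      linarith
    · have h3 := norm_sub_le (1 + (a : ℂ) * w) 1
      rw [add_sub_cancel_left, norm_one] at h3
      linarith
  have hdpos : 0 < ‖1 + (a : ℂ)⁻¹ * w‖ := by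
    have h := sub_one_le_norm_add ha hw1
    rw [show (1 + (a : ℂ)⁻¹ * w) = (a : ℂ)⁻¹ * (a + w) by
      have : (a : ℂ) ≠ 0 := by exact_mod_cast ha0.ne'
      field_simp, norm_mul, norm_inv, Complex.norm_real, Real.norm_of_nonneg ha0.le]
    have : 0 < ‖(a : ℂ) + w‖ := by linarith
    positivity
  rw [norm_div, le_div_iff₀ hdpos]
  linarith

end Factor

/-! ### Lacunary exponents -/

theorem sum_half_pow_dist_le (k : ℕ) (s : Finset ℕ) :
    ∑ i ∈ s, (1 / 2 : ℝ) ^ ((i - k) + (k - i)) ≤ 4 := by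
  obtain ⟨N, hN⟩ := s.exists_nat_subset_range
  calc ∑ i ∈ s, (1 / 2 : ℝ) ^ ((i - k) + (k - i))
      ≤ ∑ i ∈ Finset.range (k + N), (1 / 2 : ℝ) ^ ((i - k) + (k - i)) := by
        refine Finset.sum_le_sum_of_subset_of_nonneg (hN.trans ?_) fun _ _ _ => by positivity
        exact Finset.range_mono (by omega)
    _ = ∑ i ∈ Finset.range k, (1 / 2 : ℝ) ^ (k - i) + ∑ i ∈ Finset.range N, (1 / 2 : ℝ) ^ i := by
        rw [Finset.sum_range_add]
        congr 1
        · refine Finset.sum_congr rfl fun i hi => ?_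
          rw [Nat.sub_eq_zero_of_le (Finset.mem_range.1 hi).le, zero_add]
        · refine Finset.sum_congr rfl fun i _ => ?_
          congr 1
          omega
    _ ≤ ∑ i ∈ Finset.range k, (1 / 2 : ℝ) ^ (k - 1 - i) + ∑ i ∈ Finset.range N, (1 / 2 : ℝ) ^ i := by
        refine add_le_add (Finset.sum_le_sum fun i _ => ?_) le_rfl
        exact pow_le_pow_of_le_one (by norm_num) (by norm_num) (by omega)
    _ ≤ 4 := by
        rw [Finset.sum_range_reflect (fun i => (1 / 2 : ℝ) ^ i) k]
        linarith [sum_geometric_two_le k, sum_geometric_two_le N]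

/-- The properties of the exponents `n k` on which the estimates rest: lacunarity with a ratio `L`,
and ratios `weightRatio ω n k` in a range `[16, β]` whose upper end is small compared to `exp L`. -/
structure IsLacunary (ω : ℝ → ℝ) (n : ℕ → ℕ) (L : ℕ) (β : ℝ) : Prop where
  zero : n 0 = 1
  le_ratio : 16 ≤ L
  step : ∀ k, L * n k ≤ n (k + 1)
  le_weight : ∀ k, 16 ≤ weightRatio ω n k
  weight_le : ∀ k, weightRatio ω n k ≤ β
  small : β * Real.exp (-L) ≤ 1 / 16

namespace IsLacunary

variable {ω : ℝ → ℝ} {n : ℕ → ℕ} {L : ℕ} {β : ℝ} (h : IsLacunary ω n L β)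

include h

theorem pos (k : ℕ) : 0 < n k := by
  induction k with
  | zero => rw [h.zero]; exact one_pos
  | succ k ih => exact (Nat.mul_pos (by have := h.le_ratio; omega) ih).trans_le (h.step k)

theorem strictMono : StrictMono n := by
  refine strictMono_nat_of_lt_succ fun k => lt_of_lt_of_le ?_ (h.step k)
  have := h.pos k
  have := h.le_ratio
  nlinarith

theorem pow_mul_le (k d : ℕ) : L ^ d * n k ≤ n (k + d) := by
  induction d with
  | zero => simp
  | succ d ih =>
    calc L ^ (d + 1) * n k = L * (L ^ d * n k) := by ring
      _ ≤ L * n (k + d) := Nat.mul_le_mul_left _ ih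
      _ ≤ _ := h.step (k + d)

theorem sixteen_le : 16 ≤ β := (h.le_weight 0).trans (h.weight_le 0)

/-- Below the radius `1 - 1 / n k` all powers with exponent beyond `n k` are negligible. -/
theorem weight_mul_pow_le {k d : ℕ} (hd : 1 ≤ d) {r : ℝ} (hr0 : 0 ≤ r)
    (hr : r ≤ 1 - 1 / (n k : ℝ)) :
    weightRatio ω n (k + d) * r ^ n (k + d) ≤ (1 / 16) ^ d := by
  have hβ := h.sixteen_le
  have hn : (0 : ℝ) < n k := by exact_mod_cast h.pos k
  have hLd : (L : ℝ) * d ≤ (L : ℝ) ^ d := by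
    have h1 : d ≤ L ^ (d - 1) := by
      have := (Nat.lt_pow_self (n := d - 1) (by have := h.le_ratio; omega : 1 < L))
      omega
    calc (L : ℝ) * d ≤ L * L ^ (d - 1) := by gcongr; exact_mod_cast h1
      _ = L ^ d := by rw [← pow_succ', Nat.sub_add_cancel hd]
  have h1 : r ≤ Real.exp (-(1 / (n k : ℝ))) := by
    linarith [Real.add_one_le_exp (-(1 / (n k : ℝ)))]
  have h2 : r ^ n (k + d) ≤ Real.exp (-L) ^ d := by
    calc r ^ n (k + d) ≤ Real.exp (-(1 / (n k : ℝ))) ^ n (k + d) := by gcongr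
      _ = Real.exp (-((n (k + d) : ℝ) / n k)) := by
          rw [← Real.exp_nat_mul]; congr 1; ring
      _ ≤ Real.exp (-(L * d)) := by
          rw [Real.exp_le_exp, neg_le_neg_iff, le_div_iff₀ hn]
          calc (L : ℝ) * d * n k ≤ (L : ℝ) ^ d * n k := by gcongr
            _ ≤ n (k + d) := by exact_mod_cast h.pow_mul_le k d
      _ = Real.exp (-L) ^ d := by rw [← Real.exp_nat_mul]; congr 1; ring
  calc weightRatio ω n (k + d) * r ^ n (k + d) ≤ β ^ d * Real.exp (-L) ^ d := by
        refine mul_le_mul ((h.weight_le _).trans ?_) h2 (by positivity) (by positivity)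
        exact le_self_pow₀ (by linarith) (by omega)
    _ = (β * Real.exp (-L)) ^ d := by rw [mul_pow]
    _ ≤ _ := by gcongr; exact h.small

theorem one_sub_pow_le {i k : ℕ} (hik : i ≤ k) {r : ℝ} (hr : 1 - 1 / (n k : ℝ) ≤ r)
    (hr0 : 0 ≤ r) : 1 - r ^ n i ≤ (1 / 16) ^ (k - i) := by
  have hn : (0 : ℝ) < n k := by exact_mod_cast h.pos k
  have h1 := one_add_mul_le_pow (a := r - 1) (by linarith) (n i)
  rw [add_sub_cancel] at h1
  have h2 : (n i : ℝ) * (1 - r) ≤ n i / n k := by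
    rw [div_eq_mul_inv, ← one_div]
    gcongr
    linarith
  have h3 : (n i : ℝ) / n k ≤ (1 / 16) ^ (k - i) := by
    rw [div_le_iff₀ hn, one_div, inv_pow, inv_mul_eq_div, le_div_iff₀ (by positivity)]
    have h4 := h.pow_mul_le i (k - i)
    rw [Nat.add_sub_cancel' hik] at h4
    calc (n i : ℝ) * 16 ^ (k - i) ≤ n i * L ^ (k - i) := by
          gcongr; exact_mod_cast h.le_ratio
      _ ≤ n k := by rw [mul_comm]; exact_mod_cast h4
  linarith

theorem exists_radius_mem {r : ℝ} (hr : r ∈ Set.Ico (0 : ℝ) 1) :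
    ∃ k, 1 - 1 / (n k : ℝ) ≤ r ∧ r < 1 - 1 / (n (k + 1) : ℝ) := by
  have hex : ∃ k, r < 1 - 1 / (n k : ℝ) := by
    obtain ⟨k, hk⟩ := exists_nat_gt (1 / (1 - r))
    have h0 : 0 < 1 - r := by linarith [hr.2]
    have h1 : (0 : ℝ) < n k := by exact_mod_cast h.pos k
    refine ⟨k, ?_⟩
    have h2 : 1 / (1 - r) < n k := hk.trans_le (by exact_mod_cast h.strictMono.le_apply)
    rw [div_lt_comm₀ h0 h1] at h2
    linarith
  classical
  have hk0 : Nat.find hex ≠ 0 := by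
    intro h0
    have h1 := Nat.find_spec hex
    rw [h0, h.zero] at h1
    norm_num at h1
    linarith [hr.1]
  refine ⟨Nat.find hex - 1, ?_, ?_⟩
  · exact not_lt.1 (Nat.find_min hex (by omega))
  · rw [Nat.sub_add_cancel (by omega)]
    exact Nat.find_spec hex

end IsLacunary

/-- The radius `r` is away from the circle `a_i r ^ n_i = 1` carrying the zeros of the `i`-th
factor. -/
def AwayFromZeros (ω : ℝ → ℝ) (n : ℕ → ℕ) (i : ℕ) (r : ℝ) : Prop :=
  weightRatio ω n i * r ^ n i ≤ 1 / 2 ∨ 2 ≤ weightRatio ω n i * r ^ n i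

namespace IsLacunary

variable {ω : ℝ → ℝ} {n : ℕ → ℕ} {L : ℕ} {β : ℝ} (h : IsLacunary ω n L β)

include h

theorem awayFromZeros_or_succ (i : ℕ) {r : ℝ} (hr0 : 0 ≤ r) (hr1 : r < 1) :
    AwayFromZeros ω n i r ∨ AwayFromZeros ω n (i + 1) r := by
  by_cases h1 : 2 ≤ weightRatio ω n i * r ^ n i
  · exact Or.inl (Or.inr h1)
  · refine Or.inr (Or.inl ?_)
    have h2 : r ^ n i ≤ Real.exp (-1) := by
      have h3 := h.le_weight i
      have h4 : 0 ≤ r ^ n i := by positivity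
      have h5 : r ^ n i ≤ 1 / 8 := by nlinarith
      have h6 : (1 : ℝ) / 8 ≤ Real.exp (-1) := by
        rw [Real.exp_neg, ← one_div]
        gcongr
        linarith [Real.exp_one_lt_d9]
      linarith
    have h7 : r ^ n (i + 1) ≤ Real.exp (-L) := by
      calc r ^ n (i + 1) ≤ r ^ (n i * L) :=
            pow_le_pow_of_le_one hr0 hr1.le (by rw [mul_comm]; exact h.step i)
        _ = (r ^ n i) ^ L := pow_mul _ _ _
        _ ≤ Real.exp (-1) ^ L := by gcongr
        _ = Real.exp (-L) := by rw [← Real.exp_nat_mul]; congr 1; ring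
    have h8 := h.sixteen_le
    calc weightRatio ω n (i + 1) * r ^ n (i + 1) ≤ β * Real.exp (-L) :=
          mul_le_mul (h.weight_le _) h7 (by positivity) (by linarith)
      _ ≤ 1 / 2 := h.small.trans (by norm_num)

theorem awayFromZeros_radius (k : ℕ) :
    AwayFromZeros ω n k (1 - 1 / (n k : ℝ)) ∧ AwayFromZeros ω n (k + 1) (1 - 1 / (n k : ℝ)) := by
  have hnpos := h.pos k
  have hn : (0 : ℝ) < n k := by exact_mod_cast hnpos
  have hr0 : 0 ≤ 1 - 1 / (n k : ℝ) := by
    rw [sub_nonneg, div_le_one hn]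
    exact_mod_cast hnpos
  refine ⟨?_, Or.inl ((h.weight_mul_pow_le le_rfl hr0 le_rfl).trans (by norm_num))⟩
  rcases eq_or_ne (n k) 1 with h1 | h1
  · left
    simp [h1]
  · right
    have h2 : (2 : ℝ) ≤ n k := by exact_mod_cast (by omega : 2 ≤ n k)
    have h3 := exp_neg_two_mul_le_one_sub (y := 1 / (n k : ℝ)) (by positivity) (by gcongr)
    have h4 : Real.exp (-2) ≤ (1 - 1 / (n k : ℝ)) ^ n k := by
      calc Real.exp (-2) = Real.exp (-(2 * (1 / (n k : ℝ)))) ^ n k := by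
            rw [← Real.exp_nat_mul]; congr 1; field_simp
        _ ≤ _ := by gcongr
    have h5 : (1 : ℝ) / 8 ≤ Real.exp (-2) := by
      have h6 : Real.exp 2 ≤ 8 := by
        have h7 : Real.exp 2 = Real.exp 1 * Real.exp 1 := by rw [← Real.exp_add]; norm_num
        rw [h7]
        nlinarith [Real.exp_one_lt_d9, Real.exp_one_gt_d9]
      rw [Real.exp_neg, ← one_div]
      gcongr
    nlinarith [h.le_weight k]

/-- For `|z|` between `1 - 1 / n k` and `1 - 1 / n (k + 1)`, the `i`-th factor has modulus `a_i` if
`i < k` and `1` otherwise, up to an error which decays geometrically in `|i - k|`; the lower bound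
may fail for `i = k` and `i = k + 1`, near the zeros of these factors. -/
theorem norm_productFactor_bounds {k : ℕ} {z : ℂ} (h1 : 1 - 1 / (n k : ℝ) ≤ ‖z‖)
    (h2 : ‖z‖ ≤ 1 - 1 / (n (k + 1) : ℝ)) (i : ℕ) :
    ‖productFactor ω n i z‖ ≤ (if i < k then weightRatio ω n i else 1) *
        Real.exp (2 * β * (1 / 2) ^ ((i - k) + (k - i))) ∧
      ((i = k ∨ i = k + 1 → AwayFromZeros ω n i ‖z‖) →
        (if i < k then weightRatio ω n i else 1) *
          Real.exp (-(2 * β * (1 / 2) ^ ((i - k) + (k - i)))) ≤ ‖productFactor ω n i z‖) := by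
  have ha := h.le_weight i
  have haβ := h.weight_le i
  have hβ := h.sixteen_le
  have hz0 := norm_nonneg z
  have hz1 : ‖z‖ ≤ 1 := h2.trans (sub_le_self _ (by positivity))
  have hw : ‖z ^ n i‖ = ‖z‖ ^ n i := norm_pow _ _
  have hw1 : ‖z ^ n i‖ ≤ 1 := by rw [hw]; exact pow_le_one₀ hz0 hz1
  unfold productFactor AwayFromZeros
  rw [← hw]
  rcases lt_or_ge i k with hik | hik
  · -- past factors
    rw [if_pos hik, Nat.sub_eq_zero_of_le hik.le, zero_add]
    have hd : 1 - ‖z ^ n i‖ ≤ (1 / 16) ^ (k - i) := by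
      rw [hw]; exact h.one_sub_pow_le hik.le h1 hz0
    constructor
    · refine (norm_factor_le (by linarith) hw1).trans ?_
      exact le_mul_of_one_le_right (by linarith) (Real.one_le_exp (by positivity))
    · intro _
      refine le_trans ?_ (le_norm_factor_of_near_one (by linarith) hw1)
      refine mul_le_mul_of_nonneg_left ?_ (by linarith)
      have h16 : (1 / 16 : ℝ) ^ (k - i) ≤ 1 / 16 :=
        pow_le_of_le_one (by norm_num) (by norm_num) (by omega)
      refine le_trans (Real.exp_le_exp.2 ?_) (exp_neg_two_mul_le_one_sub
        (by linarith : 0 ≤ 4 * (1 - ‖z ^ n i‖)) (by linarith))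
      have hmono : (1 / 16 : ℝ) ^ (k - i) ≤ (1 / 2) ^ (k - i) := by gcongr; norm_num
      have hpos : (0 : ℝ) ≤ (1 / 2) ^ (k - i) := by positivity
      nlinarith
  · rw [if_neg (not_lt.2 hik), one_mul, one_mul, Nat.sub_eq_zero_of_le hik, add_zero]
    by_cases hmid : i ≤ k + 1
    · -- the two factors which are neither close to their boundary value nor to `1`
      have hhalf : (1 / 2 : ℝ) ≤ (1 / 2) ^ (i - k) := by
        have := pow_le_pow_of_le_one (a := (1 / 2 : ℝ)) (by norm_num) (by norm_num)
          (by omega : i - k ≤ 1)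
        simpa using this
      have hexp : β ≤ Real.exp (2 * β * (1 / 2) ^ (i - k)) := by
        have := Real.add_one_le_exp (2 * β * (1 / 2) ^ (i - k))
        nlinarith
      constructor
      · exact ((norm_factor_le (by linarith) hw1).trans haβ).trans hexp
      · intro haway
        refine le_trans ?_ (quarter_le_norm_factor (by linarith) hw1 (haway (by omega)))
        rw [Real.exp_neg, ← one_div]
        gcongr
        linarith
    · -- future factors
      obtain ⟨d, hd, rfl⟩ : ∃ d, 1 ≤ d ∧ i = (k + 1) + d := ⟨i - (k + 1), by omega, by omega⟩
      have hsmall := h.weight_mul_pow_le hd hz0 h2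
      rw [← hw] at hsmall
      have h16 : (1 / 16 : ℝ) ^ d ≤ 1 / 16 :=
        pow_le_of_le_one (by norm_num) (by norm_num) (by omega)
      obtain ⟨b1, b2⟩ := norm_factor_bounds_of_small (a := weightRatio ω n (k + 1 + d))
        (w := z ^ n (k + 1 + d)) (by linarith) (by linarith)
      have hle : 4 * (weightRatio ω n (k + 1 + d) * ‖z ^ n (k + 1 + d)‖)
          ≤ 2 * β * (1 / 2) ^ (k + 1 + d - k) := by
        rw [show k + 1 + d - k = d + 1 by omega, pow_succ]
        have hmono : (1 / 16 : ℝ) ^ d ≤ (1 / 2) ^ d := by gcongr; norm_num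
        have hpos : (0 : ℝ) ≤ (1 / 2) ^ d := by positivity
        nlinarith
      exact ⟨b2.trans (Real.exp_le_exp.2 hle), fun _ =>
        (Real.exp_le_exp.2 (neg_le_neg hle)).trans b1⟩

end IsLacunary

/-! ### The products -/

theorem one_sub_one_div_mem {k : ℕ} (hk : 0 < k) : 1 - 1 / (k : ℝ) ∈ Set.Ico (0 : ℝ) 1 := by
  have hn : (0 : ℝ) < k := by exact_mod_cast hk
  refine ⟨?_, sub_lt_self _ (by positivity)⟩
  rw [sub_nonneg, div_le_one hn]
  exact_mod_cast hk

namespace IsLacunary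

variable {ω : ℝ → ℝ} {n : ℕ → ℕ} {L : ℕ} {β : ℝ} (h : IsLacunary ω n L β)

include h

theorem radius_mem (k : ℕ) : 1 - 1 / (n k : ℝ) ∈ Set.Ico (0 : ℝ) 1 :=
  one_sub_one_div_mem (h.pos k)

theorem radius_mono {i k : ℕ} (hik : i ≤ k) : 1 - 1 / (n i : ℝ) ≤ 1 - 1 / (n k : ℝ) := by
  have hn : (0 : ℝ) < n i := by exact_mod_cast h.pos i
  have : (n i : ℝ) ≤ n k := by exact_mod_cast h.strictMono.monotone hik
  gcongr

theorem one_add_inv_mul_ne_zero (i : ℕ) {w : ℂ} (hw : ‖w‖ < 1) :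
    1 + (weightRatio ω n i : ℂ)⁻¹ * w ≠ 0 := by
  intro h0
  have ha := h.le_weight i
  have h1 : ‖(weightRatio ω n i : ℂ)⁻¹ * w‖ = 1 := by
    rw [eq_neg_of_add_eq_zero_right h0, norm_neg, norm_one]
  rw [norm_mul, norm_inv, Complex.norm_real, Real.norm_of_nonneg (by linarith),
    inv_mul_eq_div, div_eq_one_iff_eq (by linarith)] at h1
  linarith

theorem norm_pow_lt_one (i : ℕ) {z : ℂ} (hz : z ∈ ball (0 : ℂ) 1) : ‖z ^ n i‖ < 1 := by
  rw [norm_pow]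
  exact pow_lt_one₀ (norm_nonneg _) (by simpa using hz) (h.pos i).ne'

theorem differentiableOn_productFactor (i : ℕ) :
    DifferentiableOn ℂ (productFactor ω n i) (ball 0 1) := by
  unfold productFactor
  refine DifferentiableOn.div (by fun_prop) (by fun_prop) fun z hz => ?_
  exact h.one_add_inv_mul_ne_zero i (h.norm_pow_lt_one i hz)

theorem norm_productFactor_sub_one_le (i : ℕ) {z : ℂ} (hz : z ∈ ball (0 : ℂ) 1) :
    ‖productFactor ω n i z - 1‖ ≤ 2 * β * ‖z‖ ^ i := by
  have ha := h.le_weight i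
  have hβ := h.sixteen_le
  have hz1 : ‖z‖ < 1 := by simpa using hz
  have hw := h.norm_pow_lt_one i hz
  have hden := h.one_add_inv_mul_ne_zero i hw
  have hinv : ‖(weightRatio ω n i : ℂ)⁻¹‖ ≤ 1 / 16 := by
    rw [norm_inv, Complex.norm_real, Real.norm_of_nonneg (by linarith), ← one_div]
    gcongr
  have hval : productFactor ω n i z - 1 = ((weightRatio ω n i : ℂ) - (weightRatio ω n i : ℂ)⁻¹) *
      z ^ n i / (1 + (weightRatio ω n i : ℂ)⁻¹ * z ^ n i) := by
    rw [productFactor, div_sub_one hden]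
    ring
  have hdn : 15 / 16 ≤ ‖1 + (weightRatio ω n i : ℂ)⁻¹ * z ^ n i‖ := by
    have h1 := norm_sub_le (1 + (weightRatio ω n i : ℂ)⁻¹ * z ^ n i)
      ((weightRatio ω n i : ℂ)⁻¹ * z ^ n i)
    rw [add_sub_cancel_right, norm_one, norm_mul] at h1
    nlinarith [norm_nonneg (z ^ n i), norm_nonneg (weightRatio ω n i : ℂ)⁻¹]
  have hnum : ‖(weightRatio ω n i : ℂ) - (weightRatio ω n i : ℂ)⁻¹‖ ≤ β + 1 / 16 := by
    refine (norm_sub_le _ _).trans (add_le_add ?_ hinv)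
    rw [Complex.norm_real, Real.norm_of_nonneg (by linarith)]
    exact h.weight_le i
  have hpow : ‖z ^ n i‖ ≤ ‖z‖ ^ i := by
    rw [norm_pow]
    exact pow_le_pow_of_le_one (norm_nonneg _) hz1.le h.strictMono.le_apply
  rw [hval, norm_div, norm_mul, div_le_iff₀ (by linarith)]
  calc _ ≤ (β + 1 / 16) * ‖z‖ ^ i := by gcongr
    _ ≤ (2 * β * (15 / 16)) * ‖z‖ ^ i := by gcongr; linarith
    _ = 2 * β * ‖z‖ ^ i * (15 / 16) := by ring
    _ ≤ _ := by gcongr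

theorem hasProdLocallyUniformlyOn (j : ℕ) : HasProdLocallyUniformlyOn
    (fun (l : ℕ) (z : ℂ) => productFactor ω n (2 * l + j) z)
    (fun z => ∏' l, productFactor ω n (2 * l + j) z) (ball 0 1) := by
  have hβ := h.sixteen_le
  refine hasProdLocallyUniformlyOn_of_forall_compact isOpen_ball fun K hK hKc => ?_
  obtain ⟨ρ, hρ, hKρ⟩ : ∃ ρ ∈ Set.Ico (0 : ℝ) 1, ∀ z ∈ K, ‖z‖ ≤ ρ := by
    rcases K.eq_empty_or_nonempty with rfl | hne
    · exact ⟨0, by simp, by simp⟩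
    · obtain ⟨z, hz, hmax⟩ := hKc.exists_isMaxOn hne continuous_norm.continuousOn
      exact ⟨‖z‖, ⟨norm_nonneg _, by simpa using hK hz⟩, fun w hw => hmax hw⟩
  have := Summable.hasProdUniformlyOn_nat_one_add (R := ℂ) (K := K)
    (f := fun l z => productFactor ω n (2 * l + j) z - 1) (u := fun l => 2 * β * ρ ^ l) hKc
    ((summable_geometric_of_lt_one hρ.1 hρ.2).mul_left _)
    (Eventually.of_forall fun l z hz => ?_) fun l => ?_
  · simpa using this
  · refine (h.norm_productFactor_sub_one_le (2 * l + j) (hK hz)).trans ?_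
    have h1 : ‖z‖ ^ (2 * l + j) ≤ ρ ^ l :=
      (pow_le_pow_of_le_one (norm_nonneg _) (mem_ball_zero_iff.1 (hK hz)).le (by omega)).trans
        (pow_le_pow_left₀ (norm_nonneg _) (hKρ z hz) l)
    gcongr
  · exact ((h.differentiableOn_productFactor (2 * l + j)).continuousOn.mono hK).sub
      continuousOn_const

theorem analyticOnNhd_tprod (j : ℕ) :
    AnalyticOnNhd ℂ (fun z => ∏' l, productFactor ω n (2 * l + j) z) (ball 0 1) := by
  refine DifferentiableOn.analyticOnNhd ?_ isOpen_ball
  refine (h.hasProdLocallyUniformlyOn j).differentiableOn (Eventually.of_forall fun s => ?_)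
    isOpen_ball
  exact DifferentiableOn.fun_finsetProd fun l _ => h.differentiableOn_productFactor (2 * l + j)

/-- The product of the ratios with indices below `k` and of the parity of `j` telescopes. -/
theorem exists_prod_weightRatio (hω : IsDoublingFunction ω) {j : ℕ} (hj : j ≤ 1) (k : ℕ) :
    ∃ i, k ≤ i ∧ i ≤ k + 1 ∧ ∀ N, k ≤ N →
      ∏ l ∈ Finset.range N, (if 2 * l + j < k then weightRatio ω n (2 * l + j) else 1)
        = ω (1 - 1 / (n i : ℝ)) / ω (1 - 1 / (n j : ℝ)) := by
  refine ⟨2 * ((k + 1 - j) / 2) + j, by omega, by omega, fun N hN => ?_⟩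
  rw [← Finset.prod_subset (Finset.range_mono (by omega : (k + 1 - j) / 2 ≤ N))]
  · refine Finset.prod_range_induction _
      (fun l => ω (1 - 1 / (n (2 * l + j) : ℝ)) / ω (1 - 1 / (n j : ℝ))) ?_ _ fun l hl => ?_
    · rw [mul_zero, zero_add, div_self (hω.pos _ (h.radius_mem j)).ne']
    · rw [if_pos (by omega), weightRatio, show 2 * (l + 1) + j = 2 * l + j + 2 by ring]
      have := hω.pos _ (h.radius_mem (2 * l + j))
      field_simp
  · intro l _ hl
    rw [Finset.mem_range] at hl
    rw [if_neg (by omega)]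

theorem omega_radius_succ_le (hω : IsDoublingFunction ω) (k : ℕ) :
    ω (1 - 1 / (n (k + 1) : ℝ)) ≤ β * ω (1 - 1 / (n k : ℝ)) := by
  refine (hω.monotoneOn (h.radius_mem _) (h.radius_mem _)
    (h.radius_mono (Nat.le_succ (k + 1)))).trans ?_
  rw [← div_le_iff₀ (hω.pos _ (h.radius_mem k))]
  exact h.weight_le k

/-- Size of the product over the indices of the parity of `j`, on the annulus attached to `k`. The
lower bound requires that the one index among `k`, `k + 1` of that parity is not critical. -/
theorem norm_tprod_bounds (hω : IsDoublingFunction ω) {j : ℕ} (hj : j ≤ 1) {k : ℕ} {z : ℂ}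
    (h1 : 1 - 1 / (n k : ℝ) ≤ ‖z‖) (h2 : ‖z‖ ≤ 1 - 1 / (n (k + 1) : ℝ)) :
    ‖∏' l, productFactor ω n (2 * l + j) z‖ ≤ β * Real.exp (8 * β) / ω 0 * ω ‖z‖ ∧
      ((∀ i, i = k ∨ i = k + 1 → i % 2 = j → AwayFromZeros ω n i ‖z‖) →
        ω (1 - 1 / (n (k + 1) : ℝ)) ≤ β * Real.exp (8 * β) * ω (1 - 1 / (n 1 : ℝ)) *
          ‖∏' l, productFactor ω n (2 * l + j) z‖) := by
  have hβ := h.sixteen_le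
  have hzI : ‖z‖ ∈ Set.Ico (0 : ℝ) 1 := ⟨norm_nonneg _, h2.trans_lt (h.radius_mem (k + 1)).2⟩
  have hz : z ∈ ball (0 : ℂ) 1 := by simpa using hzI.2
  have hlim : Tendsto (fun N => ∏ l ∈ Finset.range N, ‖productFactor ω n (2 * l + j) z‖) atTop
      (𝓝 ‖∏' l, productFactor ω n (2 * l + j) z‖) := by
    have := ((h.hasProdLocallyUniformlyOn j).hasProd hz).tendsto_prod_nat.norm
    simpa [norm_prod] using this
  obtain ⟨i, hki, hik, hprod⟩ := h.exists_prod_weightRatio hω hj k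
  have hsum : ∀ N, ∑ l ∈ Finset.range N, 2 * β * (1 / 2 : ℝ) ^ ((2 * l + j - k) + (k - (2 * l + j)))
      ≤ 8 * β := by
    intro N
    rw [← Finset.mul_sum]
    have h3 := sum_half_pow_dist_le k ((Finset.range N).image fun l => 2 * l + j)
    rw [Finset.sum_image fun x _ y _ hxy => by
      have : 2 * x + j = 2 * y + j := hxy
      omega] at h3
    nlinarith
  have hG : ∀ l, 0 ≤ (if 2 * l + j < k then weightRatio ω n (2 * l + j) else 1) := by
    intro l
    split_ifs
    · linarith [h.le_weight (2 * l + j)]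
    · exact zero_le_one
  have hv0 : ω 0 ≤ ω (1 - 1 / (n j : ℝ)) :=
    hω.monotoneOn (by simp) (h.radius_mem j) (h.radius_mem j).1
  have hω0 := hω.pos 0 (by simp)
  have hvj := hω.pos _ (h.radius_mem j)
  have hvi := hω.pos _ (h.radius_mem i)
  have hvk := hω.pos _ (h.radius_mem k)
  have hstep := h.omega_radius_succ_le hω k
  constructor
  · have h3 : ‖∏' l, productFactor ω n (2 * l + j) z‖ ≤
        ω (1 - 1 / (n i : ℝ)) / ω (1 - 1 / (n j : ℝ)) * Real.exp (8 * β) := by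
      refine le_of_tendsto hlim ?_
      filter_upwards [eventually_ge_atTop k] with N hN
      calc ∏ l ∈ Finset.range N, ‖productFactor ω n (2 * l + j) z‖
          ≤ ∏ l ∈ Finset.range N, (if 2 * l + j < k then weightRatio ω n (2 * l + j) else 1) *
              Real.exp (2 * β * (1 / 2) ^ ((2 * l + j - k) + (k - (2 * l + j)))) :=
            Finset.prod_le_prod (fun _ _ => norm_nonneg _)
              fun l _ => (h.norm_productFactor_bounds h1 h2 (2 * l + j)).1
        _ = ω (1 - 1 / (n i : ℝ)) / ω (1 - 1 / (n j : ℝ)) * Real.exp (∑ l ∈ Finset.range N,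
              2 * β * (1 / 2 : ℝ) ^ ((2 * l + j - k) + (k - (2 * l + j)))) := by
            rw [Finset.prod_mul_distrib, hprod N hN, Real.exp_sum]
        _ ≤ _ := by gcongr; exact hsum N
    have h4 : ω (1 - 1 / (n i : ℝ)) ≤ β * ω ‖z‖ :=
      ((hω.monotoneOn (h.radius_mem i) (h.radius_mem _) (h.radius_mono hik)).trans hstep).trans
        (mul_le_mul_of_nonneg_left (hω.monotoneOn (h.radius_mem k) hzI h1) (by linarith))
    calc _ ≤ _ := h3
      _ ≤ (β * ω ‖z‖) / ω 0 * Real.exp (8 * β) := by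
          gcongr
          exact hvi.le.trans h4
      _ = _ := by ring
  · intro haway
    have h3 : ω (1 - 1 / (n i : ℝ)) / ω (1 - 1 / (n j : ℝ)) * Real.exp (-(8 * β)) ≤
        ‖∏' l, productFactor ω n (2 * l + j) z‖ := by
      refine ge_of_tendsto hlim ?_
      filter_upwards [eventually_ge_atTop k] with N hN
      calc ω (1 - 1 / (n i : ℝ)) / ω (1 - 1 / (n j : ℝ)) * Real.exp (-(8 * β))
          ≤ ω (1 - 1 / (n i : ℝ)) / ω (1 - 1 / (n j : ℝ)) * Real.exp (∑ l ∈ Finset.range N,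
              -(2 * β * (1 / 2 : ℝ) ^ ((2 * l + j - k) + (k - (2 * l + j))))) := by
            gcongr
            rw [Finset.sum_neg_distrib, neg_le_neg_iff]
            exact hsum N
        _ = ∏ l ∈ Finset.range N, (if 2 * l + j < k then weightRatio ω n (2 * l + j) else 1) *
              Real.exp (-(2 * β * (1 / 2) ^ ((2 * l + j - k) + (k - (2 * l + j))))) := by
            rw [Finset.prod_mul_distrib, hprod N hN, Real.exp_sum]
        _ ≤ _ := Finset.prod_le_prod (fun l _ => mul_nonneg (hG l) (Real.exp_nonneg _))
              fun l _ => (h.norm_productFactor_bounds h1 h2 (2 * l + j)).2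
                fun hl => haway _ hl (by omega)
    have h4 : ω (1 - 1 / (n (k + 1) : ℝ)) ≤ β * ω (1 - 1 / (n i : ℝ)) :=
      hstep.trans (mul_le_mul_of_nonneg_left
        (hω.monotoneOn (h.radius_mem k) (h.radius_mem i) (h.radius_mono hki)) (by linarith))
    have h5 : ω (1 - 1 / (n j : ℝ)) ≤ ω (1 - 1 / (n 1 : ℝ)) :=
      hω.monotoneOn (h.radius_mem j) (h.radius_mem 1) (h.radius_mono hj)
    rw [Real.exp_neg, ← div_eq_mul_inv, div_div, div_le_iff₀ (by positivity)] at h3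
    calc _ ≤ _ := h4
      _ ≤ β * (‖∏' l, productFactor ω n (2 * l + j) z‖ *
            (ω (1 - 1 / (n 1 : ℝ)) * Real.exp (8 * β))) := by
          gcongr
          exact h3.trans (by gcongr)
      _ = _ := by ring

/-- Each product separately has growth `ω`, and the two together are large on the whole disc. For
the former the circles `|z| = 1 - 1 / n k` serve, on which no factor is critical. -/
theorem exists_growth_constant (hω : IsDoublingFunction ω) : ∃ C : ℝ,
    (∀ j ≤ 1, HasGrowth ω (fun z => ∏' l, productFactor ω n (2 * l + j) z) C) ∧
      ∀ z ∈ ball (0 : ℂ) 1, ω ‖z‖ ≤ C * (‖∏' l, productFactor ω n (2 * l + 0) z‖ +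
        ‖∏' l, productFactor ω n (2 * l + 1) z‖) := by
  have hβ := h.sixteen_le
  have hω0 := hω.pos 0 (by simp)
  have hω1 := hω.pos _ (h.radius_mem 1)
  set C₁ := β * Real.exp (8 * β) / ω 0 with hC₁
  set C₂ := β * Real.exp (8 * β) * ω (1 - 1 / (n 1 : ℝ)) with hC₂
  have hC₁0 : 0 < C₁ := by positivity
  have hC₂0 : 0 < C₂ := by positivity
  refine ⟨1 + C₁ + C₂, fun j hj => ⟨by linarith, h.analyticOnNhd_tprod j, fun z hz => ?_,
    fun r hr => ?_⟩, fun z hz => ?_⟩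
  · have hzI : ‖z‖ ∈ Set.Ico (0 : ℝ) 1 := ⟨norm_nonneg _, by simpa using hz⟩
    obtain ⟨k, hk1, hk2⟩ := h.exists_radius_mem hzI
    refine (h.norm_tprod_bounds hω hj hk1 hk2.le).1.trans ?_
    exact mul_le_mul_of_nonneg_right (by linarith) (hω.pos _ hzI).le
  · obtain ⟨k, hk1, hk2⟩ := h.exists_radius_mem hr
    refine ⟨1 - 1 / (n k : ℝ), ⟨(h.radius_mem k).1, hk1⟩, fun z hz => ?_⟩
    have haway := h.awayFromZeros_radius k
    have h3 := (h.norm_tprod_bounds hω hj hz.ge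
      (hz.le.trans (h.radius_mono (Nat.le_succ k)))).2 (by
        rw [hz]
        rintro i (rfl | rfl) _
        exacts [haway.1, haway.2])
    refine ((hω.monotoneOn hr (h.radius_mem _) hk2.le).trans h3).trans ?_
    exact mul_le_mul_of_nonneg_right (by linarith) (norm_nonneg _)
  · have hzI : ‖z‖ ∈ Set.Ico (0 : ℝ) 1 := ⟨norm_nonneg _, by simpa using hz⟩
    obtain ⟨k, hk1, hk2⟩ := h.exists_radius_mem hzI
    -- at most one of the indices `k`, `k + 1` is critical, so the product without it is large
    obtain ⟨j, hj, haway⟩ : ∃ j ≤ 1, ∀ i, i = k ∨ i = k + 1 → i % 2 = j →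
        AwayFromZeros ω n i ‖z‖ := by
      rcases h.awayFromZeros_or_succ k hzI.1 hzI.2 with h3 | h3
      · refine ⟨k % 2, by omega, ?_⟩
        rintro i (rfl | rfl) hi
        exacts [h3, by omega]
      · refine ⟨(k + 1) % 2, by omega, ?_⟩
        rintro i (rfl | rfl) hi
        exacts [by omega, h3]
    have h4 := (hω.monotoneOn hzI (h.radius_mem _) hk2.le).trans
      ((h.norm_tprod_bounds hω hj hk1 hk2.le).2 haway)
    have h5 : ‖∏' l, productFactor ω n (2 * l + j) z‖ ≤
        ‖∏' l, productFactor ω n (2 * l + 0) z‖ + ‖∏' l, productFactor ω n (2 * l + 1) z‖ := by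
      obtain rfl | rfl : j = 0 ∨ j = 1 := by omega
      · exact le_add_of_nonneg_right (norm_nonneg _)
      · exact le_add_of_nonneg_left (norm_nonneg _)
    refine h4.trans (mul_le_mul (by linarith) h5 (norm_nonneg _) (by linarith))

end IsLacunary

/-! ### Choice of the exponents -/

theorem exists_pow_mul_exp_neg_two_pow_le (p : ℕ) :
    ∃ m : ℕ, 4 ≤ m ∧ ((2 : ℝ) ^ p) ^ (2 * m + 3) * Real.exp (-(2 ^ m : ℕ)) ≤ 1 / 16 := by
  have h1 : Tendsto (fun m : ℕ => ((2 : ℝ) ^ m) ^ (2 * p) * Real.exp (-(2 : ℝ) ^ m)) atTop (𝓝 0) :=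
    (Real.tendsto_pow_mul_exp_neg_atTop_nhds_zero (2 * p)).comp
      (tendsto_pow_atTop_atTop_of_one_lt one_lt_two)
  have h2 := h1.const_mul ((2 : ℝ) ^ (3 * p))
  rw [mul_zero] at h2
  obtain ⟨m, hm, hm4⟩ := ((h2.eventually_le_const (by norm_num : (0 : ℝ) < 1 / 16)).and
    (eventually_ge_atTop 4)).exists
  refine ⟨m, hm4, le_of_eq_of_le ?_ hm⟩
  push_cast
  rw [← mul_assoc]
  congr 1
  rw [← pow_mul, ← pow_mul, ← pow_add]
  congr 1
  ring

section Sequence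

variable {ω : ℝ → ℝ} (hω : IsDoublingFunction ω) {b : ℝ}
  (hb : ∀ r ∈ Set.Ioc (0 : ℝ) 1, ω (1 - r / 2) ≤ b * ω (1 - r))

include hω in
theorem omega_one_sub_one_div_mono {i k : ℕ} (hi : 0 < i) (hik : i ≤ k) :
    ω (1 - 1 / (i : ℝ)) ≤ ω (1 - 1 / (k : ℝ)) := by
  refine hω.monotoneOn (one_sub_one_div_mem hi) (one_sub_one_div_mem (hi.trans_le hik)) ?_
  have : (0 : ℝ) < i := by exact_mod_cast hi
  gcongr

include hb in
theorem omega_two_pow_mul_le (hb0 : 0 ≤ b) (m : ℕ) {k : ℕ} (hk : 0 < k) :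
    ω (1 - 1 / ((2 ^ m * k : ℕ) : ℝ)) ≤ b ^ m * ω (1 - 1 / (k : ℝ)) := by
  induction m with
  | zero => simp
  | succ m ih =>
    have hpos : 0 < 2 ^ m * k := by positivity
    have h1 : (1 : ℝ) ≤ ((2 ^ m * k : ℕ) : ℝ) := by exact_mod_cast hpos
    have h2 := hb (1 / ((2 ^ m * k : ℕ) : ℝ))
      ⟨by positivity, by rw [div_le_one (by linarith)]; exact h1⟩
    rw [show 1 / ((2 ^ m * k : ℕ) : ℝ) / 2 = 1 / ((2 ^ (m + 1) * k : ℕ) : ℝ) by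
      push_cast; rw [div_div]; ring] at h2
    calc _ ≤ _ := h2
      _ ≤ b * (b ^ m * ω (1 - 1 / (k : ℝ))) := by gcongr
      _ = _ := by ring

include hω hb in
/-- The least positive integer `N` with `ω (1 - 1 / N) ≥ t` does not overshoot `t` by more than the
doubling constant. -/
theorem exists_omega_one_sub_one_div_mem (hb1 : 1 < b) {t : ℝ} (ht : ω 0 ≤ t) :
    ∃ N : ℕ, 0 < N ∧ t ≤ ω (1 - 1 / (N : ℝ)) ∧ ω (1 - 1 / (N : ℝ)) < b * t := by
  have hω0 := hω.pos 0 (by simp)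
  have hex : ∃ N : ℕ, 0 < N ∧ t ≤ ω (1 - 1 / (N : ℝ)) := by
    obtain ⟨_, ⟨s, hs, rfl⟩, hts⟩ := not_bddAbove_iff.1 hω.unbounded t
    obtain ⟨N, hN⟩ := exists_nat_gt (1 / (1 - s))
    have h0 : 0 < 1 - s := by linarith [hs.2]
    have hN0 : (0 : ℝ) < N := (by positivity : 0 < 1 / (1 - s)).trans hN
    have hNpos : 0 < N := by exact_mod_cast hN0
    refine ⟨N, hNpos, hts.le.trans (hω.monotoneOn hs (one_sub_one_div_mem hNpos) ?_)⟩
    rw [div_lt_comm₀ h0 hN0] at hN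
    linarith
  classical
  obtain ⟨hN0, hNt⟩ := Nat.find_spec hex
  refine ⟨Nat.find hex, hN0, hNt, ?_⟩
  have hmin := fun {m} => Nat.find_min (m := m) hex
  set N := Nat.find hex
  rcases eq_or_ne N 1 with h1 | h1
  · rw [h1, Nat.cast_one, div_one, sub_self]
    nlinarith
  · have h2 := hmin (m := N - 1) (by omega)
    rw [not_and, not_le] at h2
    have h3 := h2 (by omega)
    have h4 := omega_two_pow_mul_le hb (by linarith) 1 (k := N - 1) (by omega)
    have h5 := omega_one_sub_one_div_mono hω hN0 (k := 2 ^ 1 * (N - 1)) (by omega)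
    rw [pow_one b] at h4
    nlinarith

end Sequence

/-- The exponents are chosen so that `ω (1 - 1 / n k)` grows geometrically, with a ratio which is a
large power of the doubling constant. -/
theorem IsDoublingFunction.exists_isLacunary {ω : ℝ → ℝ} (hω : IsDoublingFunction ω) :
    ∃ (n : ℕ → ℕ) (L : ℕ) (β : ℝ), IsLacunary ω n L β := by
  obtain ⟨B, hB1, hB⟩ := hω.doubling
  have hω0 := hω.pos 0 (by simp)
  -- a power of two as doubling constant turns the smallness condition into one on powers of `2 ^ m`
  obtain ⟨p, hp⟩ := pow_unbounded_of_one_lt B (one_lt_two (α := ℝ))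
  obtain ⟨m, hm4, hm⟩ := exists_pow_mul_exp_neg_two_pow_le p
  set b : ℝ := 2 ^ p with hbdef
  have hb1 : 1 < b := hB1.trans hp
  have hb2 : 2 ≤ b := by
    have hp0 : p ≠ 0 := by
      rintro rfl
      simp [hbdef] at hb1
    exact le_self_pow₀ one_le_two hp0
  have hb : ∀ r ∈ Set.Ioc (0 : ℝ) 1, ω (1 - r / 2) ≤ b * ω (1 - r) := fun r hr =>
    (hB r hr).trans (mul_le_mul_of_nonneg_right hp.le
      (hω.pos _ ⟨by linarith [hr.2], by linarith [hr.1]⟩).le)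
  set A := b ^ (m + 1) with hA
  have hA1 : 1 ≤ A := one_le_pow₀ hb1.le
  have hex : ∀ k : ℕ, ∃ N : ℕ, 0 < N ∧ A ^ k * ω 0 ≤ ω (1 - 1 / (N : ℝ)) ∧
      ω (1 - 1 / (N : ℝ)) < b * (A ^ k * ω 0) ∧ (k = 0 → N = 1) := by
    intro k
    rcases eq_or_ne k 0 with rfl | hk
    · refine ⟨1, one_pos, ?_, ?_, fun _ => rfl⟩
      · simp
      · simp only [Nat.cast_one, div_one, sub_self, pow_zero, one_mul]
        nlinarith
    · obtain ⟨N, h1, h2, h3⟩ := exists_omega_one_sub_one_div_mem hω hb hb1 (t := A ^ k * ω 0)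
        (le_mul_of_one_le_left hω0.le (one_le_pow₀ hA1))
      exact ⟨N, h1, h2, h3, fun h => absurd h hk⟩
  choose n hn0 hnlow hnup hn1 using hex
  have hA2 : A ^ 2 = b * b ^ (2 * m + 1) := by rw [hA]; ring
  have hA2' : b * A ^ 2 = b ^ (2 * m + 3) := by rw [hA]; ring
  refine ⟨n, 2 ^ m, b ^ (2 * m + 3), hn1 0 rfl, ?_, fun k => ?_, fun k => ?_, fun k => ?_, hm⟩
  · exact (by norm_num : 16 = 2 ^ 4).trans_le (Nat.pow_le_pow_right two_pos hm4)
  · by_contra hlt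
    have h1 := omega_one_sub_one_div_mono hω (hn0 (k + 1)) (not_le.1 hlt).le
    have h2 := omega_two_pow_mul_le hb (by linarith) m (hn0 k)
    have h3 : b ^ m * ω (1 - 1 / (n k : ℝ)) < b ^ m * (b * (A ^ k * ω 0)) :=
      mul_lt_mul_of_pos_left (hnup k) (by positivity)
    have h4 : b ^ m * (b * (A ^ k * ω 0)) = A ^ (k + 1) * ω 0 := by rw [hA]; ring
    linarith [hnlow (k + 1)]
  · have hpos := hω.pos _ (one_sub_one_div_mem (hn0 k))
    have h16 : (16 : ℝ) ≤ b ^ (2 * m + 1) := by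
      calc (16 : ℝ) = 2 ^ 4 := by norm_num
        _ ≤ b ^ 4 := by gcongr
        _ ≤ _ := pow_le_pow_right₀ hb1.le (by omega)
    rw [weightRatio, le_div_iff₀ hpos]
    calc 16 * ω (1 - 1 / (n k : ℝ)) ≤ b ^ (2 * m + 1) * (b * (A ^ k * ω 0)) := by
          gcongr
          exact (hnup k).le
      _ = A ^ (k + 2) * ω 0 := by rw [pow_add A k 2, hA2]; ring
      _ ≤ _ := hnlow (k + 2)
  · have hpos := hω.pos _ (one_sub_one_div_mem (hn0 k))
    rw [weightRatio, div_le_iff₀ hpos]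
    calc ω (1 - 1 / (n (k + 2) : ℝ)) ≤ b * (A ^ (k + 2) * ω 0) := (hnup (k + 2)).le
      _ = b ^ (2 * m + 3) * (A ^ k * ω 0) := by rw [← hA2']; ring
      _ ≤ _ := by gcongr; exact hnlow k

/-! ### The theorem -/

theorem theorem1 (ω : ℝ → ℝ) (hω : IsDoublingFunction ω) :
    ∃ (n : ℕ → ℕ) (f : Fin 2 → ℂ → ℂ),
      -- the functions are analytic in the disc and given by explicit infinite products
      StrictMono n ∧ (∀ k, 0 < n k) ∧ (∀ k, 1 < weightRatio ω n k) ∧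
      (∀ j : Fin 2, AnalyticOnNhd ℂ (f j) (Metric.ball 0 1)) ∧
      (∀ j : Fin 2, HasProdLocallyUniformlyOn
        (fun (k : ℕ) (z : ℂ) => productFactor ω n (2 * k + (j : ℕ)) z) (f j) (Metric.ball 0 1)) ∧
      -- joint growth on the whole disc
      (∃ C : ℝ, 0 < C ∧ ∀ z ∈ Metric.ball (0 : ℂ) 1,
        ‖f 0 z‖ + ‖f 1 z‖ ≤ C * ω ‖z‖ ∧ ω ‖z‖ ≤ C * (‖f 0 z‖ + ‖f 1 z‖)) ∧
      -- number of zeros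
      (∀ j : Fin 2, (fun r : ℝ => (countingFunction (f j) 0 r : ℝ)) =O[𝓝[<] 1]
        (fun r : ℝ => (1 - r)⁻¹)) ∧
      -- means, with constants independent of the exponent
      (∀ j : Fin 2, ∃ C : ℝ, 0 < C ∧ ∀ᶠ r in 𝓝[<] (1 : ℝ), ∀ p : ENNReal, 0 < p →
        circleMean p (f j) r ≤ C * ω r ∧ ω r ≤ C * circleMean p (f j) r) ∧
      -- value distribution
      (∀ j : Fin 2, ∀ a : ℂ,
        ComparableAlong (𝓝[<] 1) (nevanlinnaCharacteristic (f j))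
          (integratedCountingFunction (f j) a) ∧
        ComparableAlong (𝓝[<] 1) (integratedCountingFunction (f j) a)
          (fun r => Real.log (ω r))) := by
  obtain ⟨n, L, β, h⟩ := hω.exists_isLacunary
  obtain ⟨C, hgrowth, hjoint⟩ := h.exists_growth_constant hω
  have hC := (hgrowth 0 zero_le_one).one_le
  have hg : ∀ j : Fin 2, HasGrowth ω (fun z => ∏' l, productFactor ω n (2 * l + (j : ℕ)) z) C :=
    fun j => hgrowth j (by omega)
  refine ⟨n, fun j z => ∏' l, productFactor ω n (2 * l + (j : ℕ)) z, h.strictMono, h.pos,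
    fun k => by linarith [h.le_weight k], fun j => (hg j).analytic,
    fun j => h.hasProdLocallyUniformlyOn j, ⟨2 * C, by linarith, fun z hz => ⟨?_, ?_⟩⟩,
    fun j => (hg j).countingFunction_isBigO hω 0, fun j => (hg j).exists_circleMean_bounds hω,
    fun j a => (hg j).comparableAlong hω a⟩
  · have h0 := (hg 0).upper z hz
    have h1 := (hg 1).upper z hz
    linarith
  · refine (hjoint z hz).trans ?_
    simp only [Fin.val_zero, Fin.val_one]
    exact mul_le_mul_of_nonneg_right (by linarith) (by positivity)
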